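/- Let $F$ be a field, let $V$ be a finite-dimensional $F$-vector space and let $n\ge 1$ be an integer. Let $\Gamma^n(V)=(V^{\otimes n})^{S_n}$ be the $n$-th divided power of $V$, i.e. the space of tensors invariant under the permutation action of the symmetric group $S_n$, and for $v \in V$ put $[v]_n=v\otimes\cdots\otimes v\in\Gamma^n(V)$. For a finite-dimensional $F$-vector space $W$, let $\mathbb P(W)$ be the projective space of lines in $W$: for a commutative $F$-algebra $B$, the $B$-points of $\mathbb P(W)$ are the rank one locally free direct summands of $B\otimes_F W$. Let $\mathrm{PGL}(W)=\mathrm{GL}(W)/\mathbb G_m$ be the group scheme over $F$ of projective linear automorphisms of $\mathbb P(W)$: its $A$-points are the automorphisms of the $A$-scheme $\mathbb P(W)_A$ that are induced, Zariski-locally on $\mathrm{Spec}(A)$, by linear automorphisms. Consider the $n$-th Veronese embedding \[\mathrm{Ver}_n:\mathbb P(V)\to\mathbb P(\Gamma^n(V)),\qquad v\mapsto [v]_n,\] and the closed subgroup scheme $\mathrm{Stab}\subset \mathrm{PGL}(\Gamma^n(V))$ stabilising its image $Z$, i.e. $\mathrm{Stab}(A)=\{g\in \mathrm{PGL}(\Gamma^n(V))(A)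 : g(Z_A)=Z_A\}$ for every commutative $F$-algebra $A$. There is a unique homomorphism of $F$-group schemes $\Phi:\mathrm{PGL}(V)\to\mathrm{PGL}(\Gamma^n(V))$ induced by $\mathrm{GL}(V)\to\mathrm{GL}(\Gamma^n(V))$, $g\mapsto\Gamma^n(g)$, and it induces an isomorphism of linear algebraic groups over $F$ \[\phi:\mathrm{PGL}(V)\xrightarrow{\ \sim\ }\mathrm{Stab}.\] That is, for every commutative $F$-algebra $A$, the map $\Phi(A)$ is an isomorphism of $\mathrm{PGL}(V)(A)$ onto $\mathrm{Stab}(A)$, naturally in $A$. -/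

import Mathlib

open CategoryTheory TensorProduct

universe u

namespace Veronese

section Lines

variable {R : Type u} [CommRing R] {M : Type u} [AddCommGroup M] [Module R M]

/-- A submodule `L` of `M` is a *line* if it is locally free of rank one and `M ⧸ L` is
projective (so that `L` is a direct summand of `M`). -/
def IsLine (L : Submodule R M) : Prop :=
  Module.Invertible R L ∧ Module.Projective R (M ⧸ L)

theorem IsLine.exists_frame {L : Submodule R M} (h : IsLine L) :
    ∃ (s : Finset (Module.Dual R M × M)), (∀ i ∈ s, i.2 ∈ L) ∧ ∑ i ∈ s, i.1 i.2 = 1 ∧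
      ∀ i ∈ s, ∀ x ∈ L, ∀ y ∈ L, i.1 x • y = i.1 y • x := by
  classical
  obtain ⟨hinv, hproj⟩ := h
  obtain ⟨f, hf⟩ := Module.projective_lifting_property L.mkQ LinearMap.id L.mkQ_surjective
  have hmem : ∀ x, x - f (L.mkQ x) ∈ L := fun x ↦ by
    rw [← Submodule.Quotient.mk_eq_zero, Submodule.Quotient.mk_sub, sub_eq_zero]
    exact (LinearMap.congr_fun hf (L.mkQ x)).symm
  let p : M →ₗ[R] L := (LinearMap.id - f ∘ₗ L.mkQ).codRestrict L hmem
  have hp : ∀ x : L, p x = x := fun x ↦ Subtype.ext <| by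
    have : L.mkQ (x : M) = 0 := (Submodule.Quotient.mk_eq_zero L).2 x.2
    simp [p, -Submodule.mkQ_apply, this]
  obtain ⟨S, hS⟩ := ((Module.Invertible.linearEquiv R L).symm 1).exists_finset
  have h1 : ∑ i ∈ S, i.1 i.2 = 1 := by
    simpa [Module.Invertible.linearEquiv] using ((LinearEquiv.symm_apply_eq _).mp hS).symm
  have hsw : ∀ (φ : Module.Dual R L) (x y : L), φ x • y = φ y • x := fun φ x y ↦ by
    have := congrArg (fun t ↦ TensorProduct.lid R L (φ.rTensor L t))
      (Module.Invertible.tmul_comm (R := R) (m₁ := x) (m₂ := y))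
    simpa using this
  have hinj : Function.Injective (fun i : Module.Dual R L × L ↦ (i.1 ∘ₗ p, (i.2 : M))) := by
    rintro ⟨a, x⟩ ⟨b, y⟩ hab
    simp only [Prod.mk.injEq] at hab
    refine Prod.ext (LinearMap.ext fun z ↦ ?_) (Subtype.ext hab.2)
    have := LinearMap.congr_fun hab.1 (z : M)
    simpa [hp] using this
  refine ⟨S.map ⟨_, hinj⟩, ?_, ?_, ?_⟩
  · simp only [Finset.mem_map, Function.Embedding.coeFn_mk]
    rintro _ ⟨i, -, rfl⟩
    exact i.2.2
  · simpa [hp] using h1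
  · simp only [Finset.mem_map, Function.Embedding.coeFn_mk]
    rintro _ ⟨i, -, rfl⟩ x hx y hy
    have := congrArg Subtype.val (hsw i.1 ⟨x, hx⟩ ⟨y, hy⟩)
    simpa [hp ⟨x, hx⟩, hp ⟨y, hy⟩] using this

theorem IsLine.of_frame [Module.Projective R M] {L : Submodule R M} {ι : Type*} (s : Finset ι)
    (φ : ι → Module.Dual R M) (v : ι → M) (hv : ∀ i ∈ s, v i ∈ L)
    (h1 : ∑ i ∈ s, φ i (v i) = 1)
    (hsw : ∀ i ∈ s, ∀ x ∈ L, ∀ y ∈ L, φ i x • y = φ i y • x) : IsLine L := by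
  classical
  let P : M →ₗ[R] M := ∑ i ∈ s, (φ i).smulRight (v i)
  have hPa : ∀ x, P x = ∑ i ∈ s, φ i x • v i := fun x ↦ by simp [P]
  have hPmem : ∀ x, P x ∈ L := fun x ↦ by
    rw [hPa]; exact Submodule.sum_mem _ fun i hi ↦ L.smul_mem _ (hv i hi)
  have hPid : ∀ x ∈ L, P x = x := fun x hx ↦ by
    rw [hPa, Finset.sum_congr rfl fun i hi ↦ hsw i hi x hx _ (hv i hi), ← Finset.sum_smul, h1,
      one_smul]
  let w : {i // i ∈ s} → L := fun i ↦ ⟨v i, hv i i.2⟩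
  let ψ : {i // i ∈ s} → Module.Dual R L := fun i ↦ φ i ∘ₗ L.subtype
  have k1 : ∑ i, ψ i (w i) = 1 := by
    rw [← h1, ← Finset.sum_coe_sort s]; rfl
  have k2 : ∀ i (x y : L), ψ i x • y = ψ i y • x := fun i x y ↦
    Subtype.ext (hsw i i.2 x x.2 y y.2)
  have k3 : ∀ x : L, ∑ i, ψ i x • w i = x := fun x ↦ by
    simp_rw [k2 _ x, ← Finset.sum_smul, k1, one_smul]
  have k4 : ∀ (θ : Module.Dual R L) (x y : L), θ x • y = θ y • x := fun θ x y ↦ by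
    have e : ∀ z, θ z = ∑ i, ψ i z * θ (w i) := fun z ↦ by
      conv_lhs => rw [← k3 z]
      simp
    rw [e x, e y, Finset.sum_smul, Finset.sum_smul]
    refine Finset.sum_congr rfl fun i _ ↦ ?_
    rw [mul_comm, mul_smul, k2, ← mul_smul, mul_comm]
  refine ⟨⟨?_, ?_⟩, ?_⟩
  · have key : ∀ t, t = ∑ i, contractLeft R L t • (ψ i ⊗ₜ[R] w i) := by
      intro t
      induction t with
      | zero => simp
      | add a b ha hb =>
        rw [map_add]
        simp_rw [add_smul]
        rw [Finset.sum_add_distrib, ← ha, ← hb]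
      | tmul θ x =>
        rw [contractLeft_apply]
        have : ∀ i, θ x • (ψ i ⊗ₜ[R] w i) = θ ⊗ₜ (ψ i x • w i) := fun i ↦ by
          rw [← TensorProduct.smul_tmul, TensorProduct.smul_tmul']
          congr 1
          ext y
          have := congrArg (ψ i) (k4 θ x y)
          simp only [map_smul, smul_eq_mul] at this
          simp only [LinearMap.smul_apply, smul_eq_mul]
          rw [this, mul_comm]
        simp_rw [this, ← TensorProduct.tmul_sum, k3]
    intro t t' ht
    rw [key t, key t', ht]
  · intro r
    exact ⟨r • ∑ i, ψ i ⊗ₜ w i, by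
      rw [map_smul, map_sum]
      simp_rw [contractLeft_apply]
      rw [k1, smul_eq_mul, mul_one]⟩
  · refine Module.Projective.of_split (M := M)
      (L.liftQ (LinearMap.id - P) fun x hx ↦ by simp [hPid x hx]) L.mkQ ?_
    ext x
    simpa using hPmem x

end Lines

section Functors

variable {F : Type u} [Field F]

/-- For a homomorphism `k : B ⟶ C` of `F`-algebras, the map `k ⊗ id : B ⊗ V → C ⊗ V`. -/
noncomputable def push (V : Type u) [AddCommGroup V] [Module F V] {B C : CommAlgCat.{u} F}
    (k : B ⟶ C) : B ⊗[F] V →ₗ[F] C ⊗[F] V :=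
  LinearMap.rTensor V k.hom.toLinearMap

section push

variable {V : Type u} [AddCommGroup V] [Module F V] {A B C D : CommAlgCat.{u} F}

@[simp] theorem push_tmul (k : B ⟶ C) (b : B) (v : V) :
    push V k (b ⊗ₜ v) = k.hom b ⊗ₜ v := rfl

theorem push_smul (k : B ⟶ C) (b : B) (x : B ⊗[F] V) :
    push V k (b • x) = k.hom b • push V k x := by
  induction x with
  | zero => simp
  | add x y hx hy => simp [smul_add, hx, hy]
  | tmul c v => simp [TensorProduct.smul_tmul']

@[simp] theorem push_id (x : B ⊗[F] V) : push V (𝟙 B) x = x := by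
  induction x with
  | zero => simp
  | add x y hx hy => simp [hx, hy]
  | tmul c v => simp

theorem push_comp (k : B ⟶ C) (l : C ⟶ D) (x : B ⊗[F] V) :
    push V (k ≫ l) x = push V l (push V k x) := by
  induction x with
  | zero => simp
  | add x y hx hy => simp [hx, hy]
  | tmul c v => simp

/-- The `C`-submodule of `C ⊗ V` generated by the image of a `B`-submodule of `B ⊗ V`. -/
def pushSubmodule (k : B ⟶ C) (L : Submodule B (B ⊗[F] V)) : Submodule C (C ⊗[F] V) :=
  Submodule.span C (push V k '' L)

/-- The base change along `k : B ⟶ C` of a `B`-linear form on `B ⊗ V`. -/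
noncomputable def pushDual (k : B ⟶ C) (φ : Module.Dual B (B ⊗[F] V)) :
    Module.Dual C (C ⊗[F] V) :=
  LinearMap.liftBaseChange C
    (k.hom.toLinearMap ∘ₗ φ.restrictScalars F ∘ₗ TensorProduct.mk F B V 1)

theorem pushDual_push (k : B ⟶ C) (φ : Module.Dual B (B ⊗[F] V)) (x : B ⊗[F] V) :
    pushDual k φ (push V k x) = k.hom (φ x) := by
  induction x with
  | zero => simp
  | add x y hx hy => simp [hx, hy]
  | tmul b v =>
    have : b ⊗ₜ[F] v = b • ((1 : B) ⊗ₜ[F] v) := by simp [TensorProduct.smul_tmul']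
    rw [this, push_smul, LinearMap.map_smul, LinearMap.map_smul]
    simp [pushDual]

theorem pushDual_swap (k : B ⟶ C) {L : Submodule B (B ⊗[F] V)}
    {φ : Module.Dual B (B ⊗[F] V)} (hsw : ∀ x ∈ L, ∀ y ∈ L, φ x • y = φ y • x) :
    ∀ x ∈ pushSubmodule k L, ∀ y ∈ pushSubmodule k L,
      pushDual k φ x • y = pushDual k φ y • x := by
  intro x hx y hy
  induction hx using Submodule.span_induction with
  | zero => simp
  | add a b _ _ ha hb => rw [map_add, add_smul, ha, hb, smul_add]
  | smul c a _ ha => rw [map_smul, smul_assoc, ha, smul_comm]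
  | mem x hx =>
    obtain ⟨x, hx, rfl⟩ := hx
    induction hy using Submodule.span_induction with
    | zero => simp
    | add a b _ _ ha hb => rw [map_add, add_smul, ← ha, ← hb, smul_add]
    | smul c a _ ha => rw [map_smul, smul_assoc, ← ha, smul_comm]
    | mem y hy =>
      obtain ⟨y, hy, rfl⟩ := hy
      rw [pushDual_push, pushDual_push, ← push_smul, ← push_smul, hsw x hx y hy]

theorem isLine_pushSubmodule (k : B ⟶ C) {L : Submodule B (B ⊗[F] V)} (hL : IsLine L) :
    IsLine (pushSubmodule k L) := by
  obtain ⟨s, hv, h1, hsw⟩ := hL.exists_frame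
  refine IsLine.of_frame s (fun i ↦ pushDual k i.1) (fun i ↦ push V k i.2)
    (fun i hi ↦ Submodule.subset_span ⟨_, hv i hi, rfl⟩) ?_
    (fun i hi ↦ pushDual_swap k (hsw i hi))
  simp_rw [pushDual_push, ← map_sum, h1, map_one]

theorem pushSubmodule_id (L : Submodule B (B ⊗[F] V)) : pushSubmodule (𝟙 B) L = L := by
  have : push V (𝟙 B) '' (L : Set (B ⊗[F] V)) = L := by
    ext x; simp
  rw [pushSubmodule, this, Submodule.span_eq]

theorem pushSubmodule_comp (k : B ⟶ C) (l : C ⟶ D) (L : Submodule B (B ⊗[F] V)) :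
    pushSubmodule (k ≫ l) L = pushSubmodule l (pushSubmodule k L) := by
  apply le_antisymm
  · refine Submodule.span_le.2 ?_
    rintro _ ⟨x, hx, rfl⟩
    rw [push_comp]
    exact Submodule.subset_span ⟨_, Submodule.subset_span ⟨x, hx, rfl⟩, rfl⟩
  · refine Submodule.span_le.2 ?_
    rintro _ ⟨y, hy, rfl⟩
    induction hy using Submodule.span_induction with
    | zero => simp
    | add a b _ _ ha hb => rw [map_add]; exact Submodule.add_mem _ ha hb
    | smul c a _ ha => rw [push_smul]; exact Submodule.smul_mem _ _ ha
    | mem y hy =>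
      obtain ⟨x, hx, rfl⟩ := hy
      rw [← push_comp]
      exact Submodule.subset_span ⟨x, hx, rfl⟩

/-- The base change along `k : A ⟶ B` of an `A`-linear endomorphism of `A ⊗ V`. -/
noncomputable def pushEnd (k : A ⟶ B) (g : Module.End A (A ⊗[F] V)) :
    Module.End B (B ⊗[F] V) :=
  LinearMap.liftBaseChange B
    (push V k ∘ₗ g.restrictScalars F ∘ₗ TensorProduct.mk F A V 1)

theorem pushEnd_push (k : A ⟶ B) (g : Module.End A (A ⊗[F] V)) (x : A ⊗[F] V) :
    pushEnd k g (push V k x) = push V k (g x) := by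
  induction x with
  | zero => simp
  | add x y hx hy => simp [hx, hy]
  | tmul b v =>
    have : b ⊗ₜ[F] v = b • ((1 : A) ⊗ₜ[F] v) := by simp [TensorProduct.smul_tmul']
    rw [this, push_smul, LinearMap.map_smul, LinearMap.map_smul, push_smul]
    simp [pushEnd]

theorem pushEnd_unique (k : A ⟶ B) (g : Module.End A (A ⊗[F] V)) (g' : Module.End B (B ⊗[F] V))
    (h : ∀ x, g' (push V k x) = push V k (g x)) : g' = pushEnd k g := by
  refine TensorProduct.AlgebraTensorModule.curry_injective (LinearMap.ext_ring ?_)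
  ext v
  have h1 := h (1 ⊗ₜ v)
  have h2 := pushEnd_push k g (1 ⊗ₜ v)
  rw [← h2] at h1
  simpa using h1

variable (V) in
/-- Base change of endomorphisms as a homomorphism of monoids. -/
noncomputable def pushEndHom (k : A ⟶ B) :
    Module.End A (A ⊗[F] V) →* Module.End B (B ⊗[F] V) where
  toFun := pushEnd k
  map_one' := (pushEnd_unique k 1 1 fun _ ↦ rfl).symm
  map_mul' g h := (pushEnd_unique k (g * h) _ fun x ↦ by
    rw [Module.End.mul_apply, pushEnd_push, pushEnd_push, Module.End.mul_apply]).symm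

end push

variable (F) in
/-- The projective space `ℙ(V) = Gr(1, V)` of lines in `V`, as the functor sending an
`F`-algebra `B` to the set of lines in `B ⊗ V`. -/
noncomputable def projSpace (V : Type u) [AddCommGroup V] [Module F V] :
    CommAlgCat.{u} F ⥤ Type u where
  obj B := {L : Submodule B (B ⊗[F] V) // IsLine L}
  map k := ↾fun L ↦ ⟨pushSubmodule k L.1, isLine_pushSubmodule k L.2⟩
  map_id _ := ConcreteCategory.hom_ext _ _ fun L ↦ Subtype.ext (pushSubmodule_id L.1)
  map_comp k l := ConcreteCategory.hom_ext _ _ fun L ↦ Subtype.ext (pushSubmodule_comp k l L.1)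

/-- A family of permutations of `X(B)`, one for each homomorphism `A ⟶ B` of `F`-algebras. -/
abbrev Family (X : CommAlgCat.{u} F ⥤ Type u) (A : CommAlgCat.{u} F) : Type (u + 1) :=
  ∀ B : CommAlgCat.{u} F, (A ⟶ B) → Equiv.Perm (X.obj B)

/-- Restriction of families along `k : A ⟶ A'`. -/
def Family.res {X : CommAlgCat.{u} F ⥤ Type u} {A A' : CommAlgCat.{u} F} (k : A ⟶ A') :
    Family X A →* Family X A' where
  toFun f B h := f B (k ≫ h)
  map_one' := rfl
  map_mul' _ _ := rfl

/-- A family is *natural* if it is an automorphism of the functor `X_A = X ×_F A` on the category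
of `A`-algebras; by Yoneda's lemma, this is an automorphism of the `A`-scheme `X_A` when `X` is
the functor of points of a scheme. -/
def Family.IsNatural {X : CommAlgCat.{u} F ⥤ Type u} {A : CommAlgCat.{u} F}
    (f : Family X A) : Prop :=
  ∀ (B C : CommAlgCat.{u} F) (h : A ⟶ B) (k : B ⟶ C) (x : X.obj B),
    f C (h ≫ k) (X.map k x) = X.map k (f B h x)

/-- The automorphism group functor `𝐀𝐮𝐭(X)`: its `A`-points are the automorphisms of `X_A`. -/
def autPoints (X : CommAlgCat.{u} F ⥤ Type u) (A : CommAlgCat.{u} F) :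
    Subgroup (Family X A) where
  carrier := {f | f.IsNatural}
  one_mem' _ _ _ _ _ := rfl
  mul_mem' {f g} hf hg B C h k x := by
    change f C (h ≫ k) (g C (h ≫ k) (X.map k x)) = X.map k (f B h (g B h x))
    rw [hg, hf]
  inv_mem' {f} hf B C h k x := by
    change (f C (h ≫ k)).symm (X.map k x) = X.map k ((f B h).symm x)
    rw [Equiv.symm_apply_eq, hf, Equiv.apply_symm_apply]

/-- A subgroup functor of `𝐀𝐮𝐭(X)`. -/
structure AutSubgroup (X : CommAlgCat.{u} F ⥤ Type u) where
  /-- The group of `A`-points. -/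
  points : ∀ A : CommAlgCat.{u} F, Subgroup (Family X A)
  le_aut : ∀ A, points A ≤ autPoints X A
  res_mem : ∀ {A A' : CommAlgCat.{u} F} (k : A ⟶ A') {f : Family X A},
    f ∈ points A → f.res k ∈ points A'

/-- The group functor underlying a subgroup functor of `𝐀𝐮𝐭(X)`. -/
def AutSubgroup.toFunctor {X : CommAlgCat.{u} F ⥤ Type u} (G : AutSubgroup X) :
    CommAlgCat.{u} F ⥤ GrpCat.{u + 1} where
  obj A := GrpCat.of (G.points A)
  map {A A'} k := GrpCat.ofHom
    (((Family.res k).comp (G.points A).subtype).codRestrict (G.points A')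
      fun f ↦ G.res_mem k f.2)
  map_id A := by
    refine ConcreteCategory.hom_ext _ _ fun f ↦ Subtype.ext ?_
    funext B h
    change f.1 B (𝟙 A ≫ h) = f.1 B h
    rw [Category.id_comp]
  map_comp k l := by
    refine ConcreteCategory.hom_ext _ _ fun f ↦ Subtype.ext ?_
    funext B h
    change f.1 B ((k ≫ l) ≫ h) = f.1 B (k ≫ l ≫ h)
    rw [Category.assoc]

/-- The inclusion of group functors attached to an inclusion of subgroup functors. -/
def AutSubgroup.inclusion {X : CommAlgCat.{u} F ⥤ Type u} {G H : AutSubgroup X}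
    (h : ∀ A, G.points A ≤ H.points A) : G.toFunctor ⟶ H.toFunctor where
  app A := GrpCat.ofHom (Subgroup.inclusion (h A))
  naturality _ _ _ := rfl

/-- The stabiliser of a subfunctor `Z` of `X` in a subgroup functor `G` of `𝐀𝐮𝐭(X)`: its
`A`-points are the `g ∈ G(A)` such that `g(Z_A) = Z_A`. -/
def AutSubgroup.stab {X : CommAlgCat.{u} F ⥤ Type u} (G : AutSubgroup X) (Z : Subfunctor X) :
    AutSubgroup X where
  points A :=
    { carrier := {g | g ∈ G.points A ∧
        ∀ (B : CommAlgCat.{u} F) (h : A ⟶ B), g B h '' Z.obj B = Z.obj B}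
      one_mem' := ⟨one_mem _, fun B h ↦ by simp⟩
      mul_mem' := fun {f g} hf hg ↦ ⟨mul_mem hf.1 hg.1, fun B h ↦ by
        rw [Pi.mul_apply, Pi.mul_apply, Equiv.Perm.coe_mul, Set.image_comp, hg.2, hf.2]⟩
      inv_mem' := fun {f} hf ↦ ⟨inv_mem hf.1, fun B h ↦ by
        conv_lhs => rw [← hf.2 B h]
        rw [← Set.image_comp]
        convert Set.image_id _
        ext x
        simp⟩ }
  le_aut A _ hf := G.le_aut A hf.1
  res_mem k _ hf := ⟨G.res_mem k hf.1, fun B h ↦ hf.2 B (k ≫ h)⟩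

/-- The stabiliser of `Z` in `G` is contained in `G`. -/
theorem AutSubgroup.stab_le {X : CommAlgCat.{u} F ⥤ Type u} (G : AutSubgroup X)
    (Z : Subfunctor X) (A : CommAlgCat.{u} F) : (G.stab Z).points A ≤ G.points A :=
  fun _ hf ↦ hf.1

variable (V : Type u) [AddCommGroup V] [Module F V]

/-- The `A`-points of the algebraic group `GL(V)`. -/
abbrev GLPoints (A : CommAlgCat.{u} F) : Type u :=
  LinearMap.GeneralLinearGroup A (A ⊗[F] V)

/-- The map `GL(V)(A) → GL(V)(B)` attached to `k : A ⟶ B`. -/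
noncomputable def GLPoints.map {A B : CommAlgCat.{u} F} (k : A ⟶ B) :
    GLPoints V A →* GLPoints V B :=
  Units.map (pushEndHom V k)

variable {V}

theorem GLPoints.map_push {A B : CommAlgCat.{u} F} (k : A ⟶ B) (g : GLPoints V A)
    (x : A ⊗[F] V) : (GLPoints.map V k g).1 (push V k x) = push V k (g.1 x) :=
  pushEnd_push k g.1 x

theorem GLPoints.map_comp {A B C : CommAlgCat.{u} F} (k : A ⟶ B) (l : B ⟶ C)
    (g : GLPoints V A) : GLPoints.map V (k ≫ l) g = GLPoints.map V l (GLPoints.map V k g) := by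
  refine Units.ext (pushEnd_unique (k ≫ l) g.1 _ fun x ↦ ?_).symm
  rw [push_comp, GLPoints.map_push, GLPoints.map_push, push_comp]

theorem isLine_map {A : CommAlgCat.{u} F} (g : GLPoints V A) {L : Submodule A (A ⊗[F] V)}
    (hL : IsLine L) : IsLine (L.map g.1) := by
  obtain ⟨s, hv, h1, hsw⟩ := hL.exists_frame
  have hg : ∀ x, g⁻¹.1 (g.1 x) = x := fun x ↦ by
    rw [← Module.End.mul_apply, ← Units.val_mul, inv_mul_cancel]; rfl
  refine IsLine.of_frame s (fun i ↦ i.1 ∘ₗ g⁻¹.1) (fun i ↦ g.1 i.2)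
    (fun i hi ↦ Submodule.mem_map_of_mem (hv i hi)) ?_ ?_
  · simpa only [LinearMap.comp_apply, hg] using h1
  · rintro i hi _ ⟨x, hx, rfl⟩ _ ⟨y, hy, rfl⟩
    simp only [LinearMap.comp_apply, hg, ← map_smul, hsw i hi x hx y hy]

/-- The action of `GL(V)(A)` on the set of lines in `A ⊗ V`. -/
noncomputable def lineAction (A : CommAlgCat.{u} F) :
    GLPoints V A →* Equiv.Perm ((projSpace F V).obj A) where
  toFun g :=
    { toFun := fun L ↦ ⟨L.1.map g.1, isLine_map g L.2⟩
      invFun := fun L ↦ ⟨L.1.map g⁻¹.1, isLine_map g⁻¹ L.2⟩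
      left_inv := fun L ↦ Subtype.ext <| by
        change (L.1.map g.1).map g⁻¹.1 = L.1
        rw [← Submodule.map_comp, ← Module.End.mul_eq_comp, ← Units.val_mul, inv_mul_cancel]
        exact Submodule.map_id _
      right_inv := fun L ↦ Subtype.ext <| by
        change (L.1.map g⁻¹.1).map g.1 = L.1
        rw [← Submodule.map_comp, ← Module.End.mul_eq_comp, ← Units.val_mul, mul_inv_cancel]
        exact Submodule.map_id _ }
  map_one' := Equiv.ext fun L ↦ Subtype.ext (Submodule.map_id _)
  map_mul' g h := Equiv.ext fun L ↦ Subtype.ext (Submodule.map_comp _ _ _)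

/-- The natural map `GL(V)(A) → 𝐀𝐮𝐭(ℙ(V))(A)`. -/
noncomputable def glAction (A : CommAlgCat.{u} F) :
    GLPoints V A →* Family (projSpace F V) A where
  toFun g B h := lineAction B (GLPoints.map V h g)
  map_one' := by funext B h; simp
  map_mul' g g' := by funext B h; simp

theorem glAction_isNatural {A : CommAlgCat.{u} F} (g : GLPoints V A) :
    (glAction A g).IsNatural := by
  intro B C h k L
  refine Subtype.ext ?_
  change (pushSubmodule k L.1).map (GLPoints.map V (h ≫ k) g).1 =
    pushSubmodule k (L.1.map (GLPoints.map V h g).1)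
  rw [pushSubmodule, pushSubmodule, Submodule.map_span, GLPoints.map_comp]
  congr 1
  ext x
  simp only [Set.mem_image, SetLike.mem_coe, Submodule.mem_map]
  constructor
  · rintro ⟨_, ⟨y, hy, rfl⟩, rfl⟩
    exact ⟨_, ⟨y, hy, rfl⟩, (GLPoints.map_push k _ y).symm⟩
  · rintro ⟨_, ⟨y, hy, rfl⟩, rfl⟩
    exact ⟨_, ⟨y, hy, rfl⟩, GLPoints.map_push k _ y⟩

theorem res_glAction {A B : CommAlgCat.{u} F} (k : A ⟶ B) (g : GLPoints V A) :
    (glAction A g).res k = glAction B (GLPoints.map V k g) := by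
  funext C h
  change lineAction C (GLPoints.map V (k ≫ h) g) = _
  rw [GLPoints.map_comp]
  rfl

/-- The localisation map `A ⟶ A[1/a]`. -/
noncomputable def toAway (A : CommAlgCat.{u} F) (a : A) :
    A ⟶ CommAlgCat.of F (Localization.Away a) :=
  CommAlgCat.ofHom (IsScalarTower.toAlgHom F A (Localization.Away a))

/-- The family `f` is induced, over the open subset `D(a)` of `Spec A`, by an element of
`GL(V)(A[1/a])`. -/
def IsLinearAt {A : CommAlgCat.{u} F} (f : Family (projSpace F V) A) (a : A) : Prop :=
  ∃ g, f.res (toAway A a) = glAction (CommAlgCat.of F (Localization.Away a)) g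

theorem IsLinearAt.res {A B : CommAlgCat.{u} F} {f : Family (projSpace F V) A} {a : A}
    (hf : IsLinearAt f a) (k : A ⟶ B) (hk : IsUnit (k.hom a)) :
    ∃ g, f.res k = glAction B g := by
  obtain ⟨g, hg⟩ := hf
  let l : CommAlgCat.of F (Localization.Away a) ⟶ B :=
    CommAlgCat.ofHom (IsLocalization.liftAlgHom (M := Submonoid.powers a) (f := k.hom) (by
      rintro ⟨_, n, rfl⟩
      simpa using hk.pow n))
  have hl : toAway A a ≫ l = k := by
    ext x
    simp [l, toAway]
  refine ⟨GLPoints.map V l g, ?_⟩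
  rw [← res_glAction, ← hg, ← hl]
  funext C h
  change f C ((toAway A a ≫ l) ≫ h) = f C (toAway A a ≫ l ≫ h)
  rw [Category.assoc]

variable (F V) in
/-- The algebraic group `PGL(V)`, as the Zariski sheaf quotient of `GL(V)` by the subgroup of
homotheties: as homotheties are the kernel of the action of `GL(V)` on `ℙ(V)`, this is the sheaf
image of `GL(V)` in `𝐀𝐮𝐭(ℙ(V))`. Its `A`-points are the automorphisms of `ℙ(V)_A` that are
induced by linear automorphisms locally on `Spec A`. -/
def PGL : AutSubgroup (projSpace F V) where
  points A :=
    { carrier := {f | f.IsNatural ∧ Ideal.span {a : A | IsLinearAt f a} = ⊤}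
      one_mem' := by
        refine ⟨one_mem (autPoints _ A), Ideal.eq_top_of_isUnit_mem _
          (Ideal.subset_span (a := (1 : A)) ⟨1, ?_⟩) isUnit_one⟩
        rw [map_one, map_one]
      mul_mem' := fun {f g} hf hg ↦ by
        refine ⟨(autPoints _ A).mul_mem hf.1 hg.1, ?_⟩
        rw [eq_top_iff, ← Ideal.mul_top ⊤]
        nth_rw 1 [← hf.2]
        rw [← hg.2, Ideal.span_mul_span']
        refine Ideal.span_mono ?_
        rintro _ ⟨a, ha, b, hb, rfl⟩
        have hu : IsUnit ((toAway A (a * b)).hom (a * b)) :=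
          IsLocalization.Away.algebraMap_isUnit (S := Localization.Away (a * b)) (a * b)
        rw [map_mul] at hu
        obtain ⟨x, hx⟩ := ha.res (toAway A (a * b)) (isUnit_of_mul_isUnit_left hu)
        obtain ⟨y, hy⟩ := hb.res (toAway A (a * b)) (isUnit_of_mul_isUnit_right hu)
        exact ⟨x * y, by rw [map_mul, map_mul, hx, hy]⟩
      inv_mem' := fun {f} hf ↦ by
        refine ⟨(autPoints _ A).inv_mem hf.1, ?_⟩
        rw [eq_top_iff, ← hf.2]
        refine Ideal.span_mono ?_
        rintro a ⟨x, hx⟩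
        exact ⟨x⁻¹, by rw [map_inv, map_inv, hx]⟩ }
  le_aut A _ hf := hf.1
  res_mem {A A'} k f hf := by
    refine ⟨fun B C h l x ↦ ?_, ?_⟩
    · change f C (k ≫ h ≫ l) _ = (projSpace F V).map l (f B (k ≫ h) x)
      rw [← Category.assoc]
      exact hf.1 B C (k ≫ h) l x
    · have := congrArg (Ideal.map k.hom) hf.2
      rw [Ideal.map_span, Ideal.map_top] at this
      rw [eq_top_iff, ← this]
      refine Ideal.span_mono ?_
      rintro _ ⟨a, ha, rfl⟩
      have hu : IsUnit ((k ≫ toAway A' (k.hom a)).hom a) :=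
        IsLocalization.Away.algebraMap_isUnit (S := Localization.Away (k.hom a)) (k.hom a)
      exact ha.res (k ≫ toAway A' (k.hom a)) hu

theorem glAction_mem_PGL {A : CommAlgCat.{u} F} (g : GLPoints V A) :
    glAction A g ∈ (PGL F V).points A :=
  ⟨glAction_isNatural g, Ideal.eq_top_of_isUnit_mem _
    (Ideal.subset_span (a := (1 : A)) ⟨_, res_glAction _ g⟩) isUnit_one⟩

/-- The projection `GL(V)(A) → PGL(V)(A)`. -/
noncomputable def glToPGL (A : CommAlgCat.{u} F) :
    GLPoints V A →* (PGL F V).toFunctor.obj A :=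
  (glAction A).codRestrict ((PGL F V).points A) glAction_mem_PGL

end Functors

section DividedPowers

variable {R : Type u} [CommRing R] (n : ℕ) {M : Type u} [AddCommGroup M] [Module R M]

variable (R M) in
/-- The `n`-th divided power `Γⁿ(M)`: the invariants of the symmetric group acting on the `n`-th
tensor power of `M` by permutation of the factors. -/
noncomputable def Gamma : Submodule R (⨂[R] _ : Fin n, M) where
  carrier := {t | ∀ σ : Equiv.Perm (Fin n), PiTensorProduct.reindex R (fun _ ↦ M) σ t = t}
  zero_mem' σ := map_zero _
  add_mem' hx hy σ := by rw [map_add, hx σ, hy σ]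
  smul_mem' c x hx σ := by rw [map_smul, hx σ]

variable (R) in
/-- The pure symbol `[v]ₙ = v ⊗ ⋯ ⊗ v`. -/
noncomputable def symbol (v : M) : Gamma R n M :=
  ⟨⨂ₜ[R] _ : Fin n, v, fun σ ↦ by rw [PiTensorProduct.reindex_tprod]⟩

theorem symbol_smul (c : R) (v : M) : symbol R n (c • v) = c ^ n • symbol R n v := by
  refine Subtype.ext ?_
  change PiTensorProduct.tprod R (fun _ : Fin n ↦ c • v) = c ^ n • PiTensorProduct.tprod R _
  rw [(PiTensorProduct.tprod R).map_smul_univ (fun _ ↦ c) (fun _ ↦ v)]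
  simp

/-- The endomorphism `Γⁿ(g)` of `Γⁿ(M)` induced by an endomorphism `g` of `M`. -/
noncomputable def gammaMap : Module.End R M →* Module.End R (Gamma R n M) where
  toFun g := (PiTensorProduct.map fun _ ↦ g).restrict fun t ht σ ↦ by
    have := PiTensorProduct.map_reindex (fun _ : Fin n ↦ g) σ t
    rw [← this, ht σ]
  map_one' := by
    ext t
    simp
  map_mul' g h := by
    ext t
    exact LinearMap.congr_fun (PiTensorProduct.map_mul (fun _ : Fin n ↦ g) (fun _ ↦ h)) t.1

/-- The linear form on `Γⁿ(M)` with `[v]ₙ ↦ φ(v)ⁿ`. -/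
noncomputable def powDual (φ : Module.Dual R M) : Module.Dual R (Gamma R n M) :=
  PiTensorProduct.lift ((MultilinearMap.mkPiAlgebra R (Fin n) R).compLinearMap fun _ ↦ φ) ∘ₗ
    (Gamma R n M).subtype

theorem powDual_symbol (φ : Module.Dual R M) (v : M) :
    powDual n φ (symbol R n v) = φ v ^ n := by
  simp [powDual, symbol]

theorem exists_pow_frame {ι : Type*} (s : Finset ι) (a : ι → R) (h : ∑ i ∈ s, a i = 1) :
    ∃ d : ι → R, ∑ i ∈ s, d i * a i ^ n = 1 := by
  classical
  have h1 : Ideal.span (Set.range fun i : s ↦ a i) = ⊤ := by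
    rw [Ideal.eq_top_iff_one, Ideal.mem_span_range_iff_exists_fun]
    exact ⟨1, by simpa [Finset.sum_attach s a] using h⟩
  have h2 := Ideal.span_pow_eq_top _ h1 n
  rw [← Set.range_comp, Ideal.eq_top_iff_one, Ideal.mem_span_range_iff_exists_fun] at h2
  obtain ⟨c, hc⟩ := h2
  refine ⟨fun i ↦ if hi : i ∈ s then c ⟨i, hi⟩ else 0, ?_⟩
  rw [← hc, ← Finset.sum_coe_sort s]
  exact Finset.sum_congr rfl fun i _ ↦ by simp

end DividedPowers

section BaseChange

variable {F : Type u} [Field F] (n : ℕ) (V : Type u) [AddCommGroup V] [Module F V]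
  (B : CommAlgCat.{u} F)

/-- The canonical map `B ⊗ V^{⊗ n} → (B ⊗ V)^{⊗ n}`, where the tensor power on the right is
taken over `B`. -/
noncomputable def tensorBaseChange :
    B ⊗[F] (⨂[F] _ : Fin n, V) →ₗ[B] ⨂[B] _ : Fin n, B ⊗[F] V :=
  LinearMap.liftBaseChange B (PiTensorProduct.lift
    (((PiTensorProduct.tprod B).restrictScalars F).compLinearMap
      fun _ ↦ TensorProduct.mk F B V 1))

theorem tensorBaseChange_tmul (b : B) (v : Fin n → V) :
    tensorBaseChange n V B (b ⊗ₜ[F] (⨂ₜ[F] i, v i)) = b • (⨂ₜ[B] i, ((1 : B) ⊗ₜ[F] v i)) := by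
  simp [tensorBaseChange]

theorem tensorBaseChange_bijective : Function.Bijective (tensorBaseChange n V B) := by
  let b := Module.Basis.ofVectorSpace F V
  let b1 := (Basis.piTensorProduct fun _ : Fin n ↦ b).baseChange B
  let b2 := Basis.piTensorProduct fun _ : Fin n ↦ b.baseChange B
  have : tensorBaseChange n V B = (b1.equiv b2 (Equiv.refl _)).toLinearMap := by
    refine b1.ext fun p ↦ ?_
    rw [LinearEquiv.coe_coe, Module.Basis.equiv_apply]
    simp only [b1, b2, Module.Basis.baseChange_apply, Basis.piTensorProduct_apply,
      tensorBaseChange_tmul, one_smul, Equiv.refl_apply]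
  rw [this]
  exact LinearEquiv.bijective _

theorem tensorBaseChange_reindex (σ : Equiv.Perm (Fin n)) (x : B ⊗[F] (⨂[F] _ : Fin n, V)) :
    tensorBaseChange n V B
      ((PiTensorProduct.reindex F (fun _ ↦ V) σ).toLinearMap.lTensor B x) =
    PiTensorProduct.reindex B (fun _ ↦ B ⊗[F] V) σ (tensorBaseChange n V B x) := by
  induction x with
  | zero => simp
  | add x y hx hy => simp only [map_add, hx, hy]
  | tmul b t =>
    induction t using PiTensorProduct.induction_on with
    | add x y hx hy => simp only [TensorProduct.tmul_add, map_add, hx, hy]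
    | smul_tprod r v =>
      rw [TensorProduct.tmul_smul, TensorProduct.smul_tmul', LinearMap.lTensor_tmul]
      rw [LinearEquiv.coe_coe, PiTensorProduct.reindex_tprod]
      rw [tensorBaseChange_tmul, tensorBaseChange_tmul, map_smul, PiTensorProduct.reindex_tprod]

/-- The canonical map `B ⊗ Γⁿ(V) → Γⁿ_B(B ⊗ V)`. -/
noncomputable def gammaBaseChangeHom :
    B ⊗[F] Gamma F n V →ₗ[B] Gamma B n (B ⊗[F] V) :=
  (tensorBaseChange n V B ∘ₗ (Gamma F n V).subtype.baseChange B).codRestrict _ fun x σ ↦ by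
    rw [LinearMap.comp_apply, ← tensorBaseChange_reindex]
    congr 1
    induction x with
    | zero => simp
    | add x y hx hy => simp only [map_add, hx, hy]
    | tmul b t =>
      rw [LinearMap.baseChange_tmul, LinearMap.lTensor_tmul]
      exact congrArg (b ⊗ₜ[F] ·) (t.2 σ)

theorem gammaBaseChangeHom_bijective : Function.Bijective (gammaBaseChangeHom n V B) := by
  constructor
  · intro x y hxy
    have h := (tensorBaseChange_bijective n V B).1 (congrArg Subtype.val hxy)
    exact Module.Flat.lTensor_preserves_injective_linearMap (M := B) (Gamma F n V).subtype
      Subtype.val_injective h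
  · rintro ⟨y, hy⟩
    obtain ⟨x, rfl⟩ := (tensorBaseChange_bijective n V B).2 y
    classical
    let b := Module.Basis.ofVectorSpace F B
    let e := TensorProduct.equivFinsuppOfBasisLeft (N := ⨂[F] _ : Fin n, V) b
    have he : ∀ (σ : Equiv.Perm (Fin n)) (z : B ⊗[F] (⨂[F] _ : Fin n, V)) i,
        e ((PiTensorProduct.reindex F (fun _ ↦ V) σ).toLinearMap.lTensor B z) i =
          PiTensorProduct.reindex F (fun _ ↦ V) σ (e z i) := by
      intro σ z i
      induction z with
      | zero => simp
      | add x y hx hy => simp only [map_add, Finsupp.add_apply, hx, hy]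
      | tmul c t => simp [e]
    have hmem : ∀ i, e x i ∈ Gamma F n V := fun i σ ↦ by
      rw [← he]
      congr 2
      apply (tensorBaseChange_bijective n V B).1
      rw [tensorBaseChange_reindex]
      exact hy σ
    refine ⟨(e x).sum fun i _ ↦ b i ⊗ₜ ⟨e x i, hmem i⟩, Subtype.ext ?_⟩
    have hx : x = (e x).sum fun i t ↦ b i ⊗ₜ t := by
      rw [← TensorProduct.equivFinsuppOfBasisLeft_symm_apply, LinearEquiv.symm_apply_apply]
    change tensorBaseChange n V B ((Gamma F n V).subtype.baseChange B _) = _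
    congr 1
    conv_rhs => rw [hx]
    simp [Finsupp.sum]

/-- The canonical isomorphism `B ⊗ Γⁿ(V) ≃ Γⁿ_B(B ⊗ V)`. -/
noncomputable def gammaBaseChange : B ⊗[F] Gamma F n V ≃ₗ[B] Gamma B n (B ⊗[F] V) :=
  LinearEquiv.ofBijective _ (gammaBaseChangeHom_bijective n V B)

variable {V B}

/-- The pure symbol `[v]ₙ ∈ B ⊗ Γⁿ(V)` attached to `v ∈ B ⊗ V`. -/
noncomputable def pureSymbol (v : B ⊗[F] V) : B ⊗[F] Gamma F n V :=
  (gammaBaseChange n V B).symm (symbol B n v)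

theorem gammaBaseChange_pureSymbol (v : B ⊗[F] V) :
    gammaBaseChange n V B (pureSymbol n v) = symbol B n v :=
  LinearEquiv.apply_symm_apply _ _

theorem pureSymbol_smul (c : B) (v : B ⊗[F] V) :
    pureSymbol n (c • v) = c ^ n • pureSymbol n v := by
  rw [pureSymbol, symbol_smul, map_smul, pureSymbol]

theorem tprod_tmul (b : Fin n → B) (w : Fin n → V) :
    (⨂ₜ[B] i, (b i ⊗ₜ[F] w i)) = tensorBaseChange n V B ((∏ i, b i) ⊗ₜ[F] (⨂ₜ[F] i, w i)) := by
  rw [tensorBaseChange_tmul, ← (PiTensorProduct.tprod B).map_smul_univ]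
  simp [TensorProduct.smul_tmul']

theorem tensorBaseChange_push {C : CommAlgCat.{u} F} (k : B ⟶ C) (v : Fin n → B ⊗[F] V)
    (x : B ⊗[F] (⨂[F] _ : Fin n, V))
    (hx : tensorBaseChange n V B x = ⨂ₜ[B] i, v i) :
    tensorBaseChange n V C (push _ k x) = ⨂ₜ[C] i, push V k (v i) := by
  let T := LinearEquiv.ofBijective _ (tensorBaseChange_bijective n V B)
  let m₁ : MultilinearMap F (fun _ : Fin n ↦ B ⊗[F] V) (⨂[C] _ : Fin n, C ⊗[F] V) :=
    (((tensorBaseChange n V C).restrictScalars F) ∘ₗ push _ k ∘ₗ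
      (T.symm.toLinearMap.restrictScalars F)).compMultilinearMap
      ((PiTensorProduct.tprod B).restrictScalars F)
  let m₂ : MultilinearMap F (fun _ : Fin n ↦ B ⊗[F] V) (⨂[C] _ : Fin n, C ⊗[F] V) :=
    ((PiTensorProduct.tprod C).restrictScalars F).compLinearMap fun _ ↦ push V k
  have key : m₁ = m₂ := by
    refine Module.Basis.ext_multilinear (fun _ ↦ (Module.Basis.ofVectorSpace F B).tensorProduct
      (Module.Basis.ofVectorSpace F V)) fun p ↦ ?_
    simp only [Module.Basis.tensorProduct_apply']
    change tensorBaseChange n V C (push _ k (T.symm (⨂ₜ[B] i, _))) = ⨂ₜ[C] i, push V k _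
    rw [tprod_tmul]
    have : ∀ z, T.symm (tensorBaseChange n V B z) = z := T.symm_apply_apply
    rw [this, push_tmul, map_prod, ← tprod_tmul]
    rfl
  have h := congrFun (congrArg DFunLike.coe key) v
  change tensorBaseChange n V C (push _ k (T.symm (⨂ₜ[B] i, v i))) = _ at h
  rw [← hx] at h
  have : T.symm (tensorBaseChange n V B x) = x := T.symm_apply_apply x
  rw [this] at h
  exact h

theorem push_pureSymbol {C : CommAlgCat.{u} F} (k : B ⟶ C) (v : B ⊗[F] V) :
    push _ k (pureSymbol n v) = pureSymbol n (push V k v) := by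
  apply (gammaBaseChange n V C).injective
  rw [gammaBaseChange_pureSymbol]
  refine Subtype.ext ?_
  have h := tensorBaseChange_push n k (fun _ ↦ v)
    ((Gamma F n V).subtype.baseChange B (pureSymbol n v))
    (congrArg Subtype.val (gammaBaseChange_pureSymbol n v))
  refine Eq.trans ?_ h
  change tensorBaseChange n V C ((Gamma F n V).subtype.baseChange C _) = _
  congr 1
  generalize pureSymbol n v = t
  induction t with
  | zero => simp
  | add x y hx hy => simp only [map_add, hx, hy]
  | tmul b t => rfl

/-- For a submodule `L` of `B ⊗ V`, the submodule of `B ⊗ Γⁿ(V)` spanned by the pure symbols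
`[v]ₙ`, `v ∈ L`. If `L` is a line, this is the line `Γⁿ(L)`. -/
noncomputable def symbolSpan (L : Submodule B (B ⊗[F] V)) : Submodule B (B ⊗[F] Gamma F n V) :=
  Submodule.span B (pureSymbol n '' L)

/-- In a line `L`, pure symbols are expressed in terms of those of a frame. -/
theorem pureSymbol_eq_sum {L : Submodule B (B ⊗[F] V)} {ι : Type*} (s : Finset ι)
    (φ : ι → Module.Dual B (B ⊗[F] V)) (v : ι → B ⊗[F] V) (d : ι → B)
    (hv : ∀ i ∈ s, v i ∈ L) (h1 : ∑ i ∈ s, d i * φ i (v i) ^ n = 1)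
    (hsw : ∀ i ∈ s, ∀ x ∈ L, ∀ y ∈ L, φ i x • y = φ i y • x) (x : B ⊗[F] V) (hx : x ∈ L) :
    pureSymbol n x = ∑ i ∈ s, (d i * φ i x ^ n) • pureSymbol n (v i) := by
  conv_lhs => rw [← one_smul B (pureSymbol n x), ← h1, Finset.sum_smul]
  refine Finset.sum_congr rfl fun i hi ↦ ?_
  rw [mul_smul, mul_smul, ← pureSymbol_smul, ← pureSymbol_smul, hsw i hi x hx _ (hv i hi)]

theorem isLine_symbolSpan {L : Submodule B (B ⊗[F] V)} (hL : IsLine L) :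
    IsLine (symbolSpan n L) := by
  obtain ⟨s, hv, h1, hsw⟩ := hL.exists_frame
  obtain ⟨d, hd⟩ := exists_pow_frame n s (fun i ↦ i.1 i.2) h1
  have hP : ∀ (φ : Module.Dual B (B ⊗[F] V)) (x : B ⊗[F] V),
      (powDual n φ ∘ₗ (gammaBaseChange n V B).toLinearMap) (pureSymbol n x) = φ x ^ n :=
    fun φ x ↦ by
      rw [LinearMap.comp_apply, LinearEquiv.coe_coe, gammaBaseChange_pureSymbol, powDual_symbol]
  refine IsLine.of_frame s (fun i ↦ d i • (powDual n i.1 ∘ₗ (gammaBaseChange n V B).toLinearMap))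
    (fun i ↦ pureSymbol n i.2) (fun i hi ↦ Submodule.subset_span ⟨_, hv i hi, rfl⟩) ?_ ?_
  · simp_rw [LinearMap.smul_apply, hP, smul_eq_mul, hd]
  · intro i hi x hx y hy
    induction hx using Submodule.span_induction with
    | zero => simp
    | add a b _ _ ha hb => rw [map_add, add_smul, ha, hb, smul_add]
    | smul c a _ ha => rw [map_smul, smul_assoc, ha, smul_comm]
    | mem x hx =>
      obtain ⟨x, hx, rfl⟩ := hx
      induction hy using Submodule.span_induction with
      | zero => simp
      | add a b _ _ ha hb => rw [map_add, add_smul, ← ha, ← hb, smul_add]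
      | smul c a _ ha => rw [map_smul, smul_assoc, ← ha, smul_comm]
      | mem y hy =>
        obtain ⟨y, hy, rfl⟩ := hy
        simp only [LinearMap.smul_apply, hP, smul_eq_mul, mul_smul]
        rw [← pureSymbol_smul, ← pureSymbol_smul, hsw i hi x hx y hy]

theorem symbolSpan_pushSubmodule {C : CommAlgCat.{u} F} (k : B ⟶ C)
    {L : Submodule B (B ⊗[F] V)} (hL : IsLine L) :
    symbolSpan n (pushSubmodule k L) = pushSubmodule k (symbolSpan n L) := by
  apply le_antisymm
  · obtain ⟨s, hv, h1, hsw⟩ := hL.exists_frame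
    obtain ⟨d, hd⟩ := exists_pow_frame n s (fun i ↦ i.1 i.2) h1
    refine Submodule.span_le.2 ?_
    rintro _ ⟨y, hy, rfl⟩
    rw [pureSymbol_eq_sum n (L := pushSubmodule k L) s (fun i ↦ pushDual k i.1) (fun i ↦ push V k i.2)
      (fun i ↦ k.hom (d i)) (fun i hi ↦ Submodule.subset_span ⟨_, hv i hi, rfl⟩) ?_
      (fun i hi ↦ pushDual_swap k (hsw i hi)) y hy]
    · refine Submodule.sum_mem _ fun i hi ↦ Submodule.smul_mem _ _ ?_
      rw [← push_pureSymbol]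
      exact Submodule.subset_span ⟨_, Submodule.subset_span ⟨_, hv i hi, rfl⟩, rfl⟩
    · simp_rw [pushDual_push, ← map_pow, ← map_mul, ← map_sum, hd, map_one]
  · refine Submodule.span_le.2 ?_
    rintro _ ⟨y, hy, rfl⟩
    induction hy using Submodule.span_induction with
    | zero => simp
    | add a b _ _ ha hb => rw [map_add]; exact Submodule.add_mem _ ha hb
    | smul c a _ ha => rw [push_smul]; exact Submodule.smul_mem _ _ ha
    | mem y hy =>
      obtain ⟨x, hx, rfl⟩ := hy
      rw [push_pureSymbol]
      exact Submodule.subset_span ⟨_, Submodule.subset_span ⟨x, hx, rfl⟩, rfl⟩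

variable (F V) in
/-- The `n`-th Veronese embedding `Verₙ : ℙ(V) → ℙ(Γⁿ(V))`, `v ↦ [v]ₙ`. -/
noncomputable def veronese : projSpace F V ⟶ projSpace F (Gamma F n V) where
  app _ := ↾fun L ↦ ⟨symbolSpan n L.1, isLine_symbolSpan n L.2⟩
  naturality _ _ k := ConcreteCategory.hom_ext _ _ fun L ↦
    Subtype.ext (symbolSpan_pushSubmodule n k L.2)

/-- The natural map `GL(V)(A) → GL(Γⁿ(V))(A)`, `g ↦ Γⁿ(g)`. -/
noncomputable def glGamma (A : CommAlgCat.{u} F) :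
    GLPoints V A →* GLPoints (Gamma F n V) A :=
  (LinearMap.GeneralLinearGroup.congrLinearEquiv (gammaBaseChange n V A).symm).toMonoidHom.comp
    (Units.map (gammaMap n))

theorem glGamma_pureSymbol {A : CommAlgCat.{u} F} (g : GLPoints V A) (v : A ⊗[F] V) :
    (glGamma n A g).1 (pureSymbol n v) = pureSymbol n (g.1 v) := by
  change (gammaBaseChange n V A).symm (gammaMap n g.1 (gammaBaseChange n V A _)) = _
  rw [gammaBaseChange_pureSymbol, pureSymbol]
  congr 1
  refine Subtype.ext ?_
  change PiTensorProduct.map (fun _ ↦ g.1) (⨂ₜ[A] _ : Fin n, v) = _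
  rw [PiTensorProduct.map_tprod]
  rfl

/-- A homomorphism of group functors `PGL(V) → PGL(Γⁿ(V))` is the *natural arrow* if it is induced
by `GL(V) → GL(Γⁿ(V))`, `g ↦ Γⁿ(g)`. -/
def IsNaturalArrow (Φ : (PGL F V).toFunctor ⟶ (PGL F (Gamma F n V)).toFunctor) : Prop :=
  ∀ (A : CommAlgCat.{u} F) (g : GLPoints V A),
    (Φ.app A).hom (glToPGL A g) = glToPGL A (glGamma n A g)

variable (F V) in
/-- The stabiliser in `PGL(Γⁿ(V))` of the image of the `n`-th Veronese embedding. -/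
noncomputable def veroneseStab : AutSubgroup (projSpace F (Gamma F n V)) :=
  (PGL F (Gamma F n V)).stab (Subfunctor.range (veronese F n V))

variable (F V) in
/-- The inclusion of the stabiliser of the Veronese image in `PGL(Γⁿ(V))`. -/
noncomputable def veroneseStabInclusion :
    (veroneseStab F n V).toFunctor ⟶ (PGL F (Gamma F n V)).toFunctor :=
  AutSubgroup.inclusion (AutSubgroup.stab_le _ _)

end BaseChange

end Veronese

/-! The substance is that an automorphism `g` of `A ⊗ Γⁿ(V)` preserving the Veronese image is,
Zariski locally on `Spec A` and up to a unit, of the form `Γⁿ(h)`. Since `A` is an arbitrary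
`F`-algebra, possibly non-reduced, geometric points do not suffice. Instead `g` is tested on the
formal generic point of an affine chart: a basis of `V` indexed by `Option σ` gives the vector `(1,
X)` over `A[[X]]`, and after localising `A` the stabiliser condition reads `g [(1, X)] = u • [W]`,
with `u` a unit series and `W` a tuple of series, one of whose entries is `1`.

Linear forms on `Γⁿ(V)` are forms of degree `n` in the coordinates of `V`. Applied to `g`, this says
that every product `u * ∏ W (I j)` of `n` entries is a polynomial of degree at most `n`. Applied to
`g⁻¹`, together with Euler's identity, it shows that the matrix of first order coefficients of `W`
is invertible (`exists_mul_jet_eq_one`). Correcting `g` by this matrix makes the formal map tangent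
to the identity. The degree bound then forces `W` to be a homography `X / l` with `l` affine linear,
and `u = c * l ^ n` (`exists_denominator`). Hence `g` and `c • Γⁿ(h)`, for an explicit `h`, agree at
the generic pure symbol, and therefore everywhere (`end_eq_of_generic`): the monomials in `(1, X)`
separate the multidegrees, and a symmetric tensor has the same coefficient at all words of one
multidegree.

The rest is descent. Homotheties of `V` induce homotheties of `Γⁿ(V)`, so the local automorphisms
`Γⁿ(h)` attached to a point of `PGL(V)` act compatibly on lines and glue to a point of `PGL(Γⁿ(V))`
(`GluingDatum`). The Veronese map is injective on points and equivariant for this construction,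
which gives injectivity of the arrow. For surjectivity, an element of the stabiliser is restricted
to `ℙ(V)` along the Veronese map; the local lifting theorem shows that the restriction is locally
linear and that gluing gives back the original element. -/

namespace Veronese

/-! ### Lines in a module: criteria that can be checked locally. -/

section Lines

variable {R : Type u} [CommRing R] {M : Type u} [AddCommGroup M] [Module R M]

/-- The flip is trivial on the tensor square of an invertible module; contract `x ⊗ y = y ⊗ x` with
`φ`. Unlike the relation carried by a frame, this one is available for every linear form. -/
theorem IsLine.swap {L : Submodule R M} (h : IsLine L) (φ : Module.Dual R M) {x y : M}
    (hx : x ∈ L) (hy : y ∈ L) : φ x • y = φ y • x := by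
  have := h.1
  have key := congrArg (fun t ↦ TensorProduct.lid R L ((φ ∘ₗ L.subtype).rTensor L t))
    (Module.Invertible.tmul_comm (R := R) (m₁ := (⟨x, hx⟩ : L)) (m₂ := (⟨y, hy⟩ : L)))
  simpa using congrArg Subtype.val key

theorem IsLine.span_eq_top {L : Submodule R M} (h : IsLine L) :
    Ideal.span {r | ∃ φ : Module.Dual R M, ∃ v ∈ L, φ v = r} = ⊤ := by
  obtain ⟨s, hv, h1, -⟩ := h.exists_frame
  rw [Ideal.eq_top_iff_one, ← h1]
  exact Ideal.sum_mem _ fun i hi ↦ Ideal.subset_span ⟨i.1, i.2, hv i hi, rfl⟩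

/-- The coefficients of a relation expressing `1` are absorbed into the linear forms, which turns it
into a frame. Both hypotheses are Zariski local, and this is what makes the criterion useful. -/
theorem IsLine.of_span_eq_top [Module.Projective R M] {L : Submodule R M}
    (hsw : ∀ (φ : Module.Dual R M), ∀ x ∈ L, ∀ y ∈ L, φ x • y = φ y • x)
    (h : Ideal.span {r | ∃ φ : Module.Dual R M, ∃ v ∈ L, φ v = r} = ⊤) : IsLine L := by
  classical
  rw [Ideal.eq_top_iff_one, Submodule.mem_span_set'] at h
  obtain ⟨k, c, r, h⟩ := h
  choose φ v hv hφ using fun i ↦ (r i).2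
  refine IsLine.of_frame Finset.univ (fun i ↦ c i • φ i) v (fun i _ ↦ hv i) ?_ ?_
  · simpa [hφ] using h
  · intro i _ x hx y hy
    simp only [LinearMap.smul_apply, smul_assoc, hsw (φ i) x hx y hy]

/-- A vector on which some linear form takes the value `1` spans a line. -/
theorem isLine_span_singleton [Module.Projective R M] (φ : Module.Dual R M) {v : M}
    (h : φ v = 1) : IsLine (Submodule.span R {v}) := by
  refine IsLine.of_frame (Finset.univ : Finset Unit) (fun _ ↦ φ) (fun _ ↦ v)
    (fun _ _ ↦ Submodule.mem_span_singleton_self v) (by simpa using h) ?_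
  intro _ _ x hx y hy
  obtain ⟨a, rfl⟩ := Submodule.mem_span_singleton.1 hx
  obtain ⟨b, rfl⟩ := Submodule.mem_span_singleton.1 hy
  simp [h, smul_smul, mul_comm]

theorem IsLine.eq_span_singleton {L : Submodule R M} (h : IsLine L) (φ : Module.Dual R M) {v : M}
    (hv : v ∈ L) (h1 : φ v = 1) : L = Submodule.span R {v} := by
  refine le_antisymm (fun x hx ↦ ?_) ((Submodule.span_singleton_le_iff_mem _ _).2 hv)
  rw [← one_smul R x, ← h1, ← h.swap φ hx hv]
  exact Submodule.smul_mem _ _ (Submodule.mem_span_singleton_self v)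

end Lines

/-! ### Zariski localisation of vectors, submodules and lines. -/

section Localisation

variable {F : Type u} [Field F] {W : Type u} [AddCommGroup W] [Module F W]
  {A B C D : CommAlgCat.{u} F}

theorem toAway_isUnit (b : B) : IsUnit ((toAway B b).hom b) :=
  IsLocalization.Away.algebraMap_isUnit (S := Localization.Away b) b

theorem toAway_lift (k : A ⟶ B) {a : A} (hk : IsUnit (k.hom a)) :
    ∃ l : CommAlgCat.of F (Localization.Away a) ⟶ B, toAway A a ≫ l = k :=
  ⟨CommAlgCat.ofHom (IsLocalization.liftAlgHom (M := Submonoid.powers a) (f := k.hom) (by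
      rintro ⟨_, n, rfl⟩
      simpa using hk.pow n)), by ext x; simp [toAway]⟩

theorem toAway_surj (b : B) (c : CommAlgCat.of F (Localization.Away b)) :
    ∃ (n : ℕ) (x : B), (toAway B b).hom b ^ n * c = (toAway B b).hom x := by
  obtain ⟨⟨x, ⟨_, n, rfl⟩⟩, h⟩ := IsLocalization.surj (Submonoid.powers b) (c : Localization.Away b)
  refine ⟨n, x, ?_⟩
  rw [mul_comm, ← map_pow]
  exact h

theorem toAway_eq_zero {b : B} {x : B} (h : (toAway B b).hom x = 0) : ∃ n : ℕ, b ^ n * x = 0 := by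
  obtain ⟨⟨_, n, rfl⟩, h⟩ := (IsLocalization.map_eq_zero_iff (Submonoid.powers b)
    (Localization.Away b) x).1 h
  exact ⟨n, h⟩

theorem push_repr {ι : Type*} (e : Module.Basis ι F W) (k : B ⟶ C) (x : B ⊗[F] W) (i : ι) :
    (e.baseChange C).repr (push W k x) i = k.hom ((e.baseChange B).repr x i) := by
  induction x with
  | zero => simp
  | add x y hx hy => simp [hx, hy]
  | tmul b w => simp

theorem push_toAway_surj (b : B) (y : CommAlgCat.of F (Localization.Away b) ⊗[F] W) :
    ∃ (n : ℕ) (x : B ⊗[F] W), (toAway B b).hom b ^ n • y = push W (toAway B b) x := by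
  induction y with
  | zero => exact ⟨0, 0, by simp⟩
  | tmul c w =>
    obtain ⟨n, x, h⟩ := toAway_surj b c
    exact ⟨n, x ⊗ₜ w, by rw [push_tmul, ← h, TensorProduct.smul_tmul', smul_eq_mul]⟩
  | add y z hy hz =>
    obtain ⟨n, x, hx⟩ := hy
    obtain ⟨m, x', hx'⟩ := hz
    refine ⟨n + m, b ^ m • x + b ^ n • x', ?_⟩
    rw [map_add, push_smul, push_smul, ← hx, ← hx', smul_add, smul_smul, smul_smul, map_pow,
      map_pow]
    congr 2 <;> ring

/-- Each coordinate is killed by some power of `b`; finite dimension allows a single exponent for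
all of them. -/
theorem push_toAway_eq_zero [FiniteDimensional F W] {b : B} {x : B ⊗[F] W}
    (h : push W (toAway B b) x = 0) : ∃ n : ℕ, b ^ n • x = 0 := by
  let e := Module.finBasis F W
  have hi : ∀ i, ∃ n : ℕ, b ^ n * (e.baseChange B).repr x i = 0 := fun i ↦ toAway_eq_zero <| by
    rw [← push_repr, h]; simp
  choose n hn using hi
  refine ⟨∑ i, n i, (e.baseChange B).repr.injective (Finsupp.ext fun i ↦ ?_)⟩
  rw [map_smul, map_zero, Finsupp.smul_apply, smul_eq_mul, Finsupp.zero_apply,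
    ← Finset.add_sum_erase _ _ (Finset.mem_univ i), pow_add, mul_right_comm, hn, zero_mul]

theorem exists_of_mem_pushSubmodule {b : B} {N : Submodule B (B ⊗[F] W)}
    {y : CommAlgCat.of F (Localization.Away b) ⊗[F] W}
    (h : y ∈ pushSubmodule (toAway B b) N) :
    ∃ (n : ℕ), ∃ x ∈ N, (toAway B b).hom b ^ n • y = push W (toAway B b) x := by
  induction h using Submodule.span_induction with
  | mem y hy =>
    obtain ⟨x, hx, rfl⟩ := hy
    exact ⟨0, x, hx, by simp⟩
  | zero => exact ⟨0, 0, zero_mem _, by simp⟩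
  | add y z _ _ hy hz =>
    obtain ⟨n, x, hxN, hx⟩ := hy
    obtain ⟨m, x', hxN', hx'⟩ := hz
    refine ⟨n + m, b ^ m • x + b ^ n • x',
      N.add_mem (N.smul_mem _ hxN) (N.smul_mem _ hxN'), ?_⟩
    rw [map_add, push_smul, push_smul, ← hx, ← hx', smul_add, smul_smul, smul_smul, map_pow,
      map_pow]
    congr 2 <;> ring
  | smul c y _ hy =>
    obtain ⟨n, x, hxN, hx⟩ := hy
    obtain ⟨m, r, hr⟩ := toAway_surj b c
    refine ⟨n + m, r • x, N.smul_mem _ hxN, ?_⟩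
    rw [push_smul, ← hx, ← hr, smul_smul, smul_smul]
    congr 1
    ring

theorem push_mem_pushSubmodule (k : B ⟶ C) {N : Submodule B (B ⊗[F] W)} {x : B ⊗[F] W}
    (h : x ∈ N) : push W k x ∈ pushSubmodule k N :=
  Submodule.subset_span ⟨x, h, rfl⟩

theorem exists_pow_smul_mem [FiniteDimensional F W] {b : B} {N : Submodule B (B ⊗[F] W)}
    {x : B ⊗[F] W} (h : push W (toAway B b) x ∈ pushSubmodule (toAway B b) N) :
    ∃ n : ℕ, b ^ n • x ∈ N := by
  obtain ⟨n, y, hy, hxy⟩ := exists_of_mem_pushSubmodule h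
  have h0 : push W (toAway B b) (b ^ n • x - y) = 0 := by
    rw [map_sub, push_smul, ← hxy, map_pow, sub_self]
  obtain ⟨m, hm⟩ := push_toAway_eq_zero h0
  refine ⟨m + n, ?_⟩
  rw [smul_sub, sub_eq_zero, smul_smul, ← pow_add] at hm
  rw [hm]
  exact N.smul_mem _ hy

/-- Membership in a submodule of `B ⊗ W` is Zariski local on `Spec B`. -/
theorem mem_of_local [FiniteDimensional F W] {S : Set B} (hS : Ideal.span S = ⊤)
    {N : Submodule B (B ⊗[F] W)} {x : B ⊗[F] W}
    (h : ∀ b ∈ S, push W (toAway B b) x ∈ pushSubmodule (toAway B b) N) : x ∈ N :=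
  Submodule.mem_of_span_eq_top_of_smul_pow_mem N S hS x fun r ↦ exists_pow_smul_mem (h r r.2)

theorem eq_of_local [FiniteDimensional F W] {S : Set B} (hS : Ideal.span S = ⊤)
    {N N' : Submodule B (B ⊗[F] W)}
    (h : ∀ b ∈ S, pushSubmodule (toAway B b) N = pushSubmodule (toAway B b) N') : N = N' :=
  le_antisymm (fun _ hx ↦ mem_of_local hS fun b hb ↦ h b hb ▸ push_mem_pushSubmodule _ hx)
    fun _ hx ↦ mem_of_local hS fun b hb ↦ h b hb ▸ push_mem_pushSubmodule _ hx

theorem eq_zero_of_local [FiniteDimensional F W] {S : Set B} (hS : Ideal.span S = ⊤)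
    {x : B ⊗[F] W} (h : ∀ b ∈ S, push W (toAway B b) x = 0) : x = 0 :=
  (Submodule.mem_bot B).1 <| mem_of_local hS fun b hb ↦ h b hb ▸ zero_mem _

theorem span_image_eq_top (k : A ⟶ B) {S : Set A} (hS : Ideal.span S = ⊤) :
    Ideal.span (k.hom '' S) = ⊤ := by
  have := congrArg (Ideal.map k.hom) hS
  rwa [Ideal.map_span, Ideal.map_top] at this

theorem GLPoints.map_id (g : GLPoints W A) : GLPoints.map W (𝟙 A) g = g :=
  Units.ext (pushEnd_unique (𝟙 A) g.1 g.1 fun x ↦ by simp).symm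

theorem pushSubmodule_map (k : B ⟶ C) (g : GLPoints W B) (L : Submodule B (B ⊗[F] W)) :
    pushSubmodule k (L.map g.1) = (pushSubmodule k L).map (GLPoints.map W k g).1 := by
  rw [pushSubmodule, pushSubmodule, Submodule.map_span]
  congr 1
  ext x
  simp only [Set.mem_image, SetLike.mem_coe, Submodule.mem_map]
  constructor
  · rintro ⟨_, ⟨y, hy, rfl⟩, rfl⟩
    exact ⟨_, ⟨y, hy, rfl⟩, GLPoints.map_push k _ y⟩
  · rintro ⟨_, ⟨y, hy, rfl⟩, rfl⟩
    exact ⟨_, ⟨y, hy, rfl⟩, (GLPoints.map_push k _ y).symm⟩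

theorem pushSubmodule_span_singleton (k : B ⟶ C) (x : B ⊗[F] W) :
    pushSubmodule k (Submodule.span B {x}) = Submodule.span C {push W k x} := by
  refine le_antisymm (Submodule.span_le.2 ?_)
    ((Submodule.span_singleton_le_iff_mem _ _).2
      (push_mem_pushSubmodule k (Submodule.mem_span_singleton_self x)))
  rintro _ ⟨y, hy, rfl⟩
  obtain ⟨b, rfl⟩ := Submodule.mem_span_singleton.1 hy
  rw [push_smul]
  exact Submodule.smul_mem _ _ (Submodule.mem_span_singleton_self _)

theorem exists_pow_mem_of_map_eq_top {b : B} {J : Ideal B}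
    (h : J.map (toAway B b).hom = ⊤) : ∃ n : ℕ, b ^ n ∈ J := by
  by_contra hcon
  refine (IsLocalization.map_algebraMap_ne_top_iff_disjoint (Submonoid.powers b)
    (Localization.Away b) J).2 ?_ h
  rw [Set.disjoint_left]
  rintro _ ⟨n, rfl⟩ hn
  exact hcon ⟨n, hn⟩

/-- The swap relation is an identity between vectors, hence local. For the ideal of values, a power
of each `b` is shown to lie in it. -/
theorem isLine_of_local [FiniteDimensional F W] {S : Set B} (hS : Ideal.span S = ⊤)
    {N : Submodule B (B ⊗[F] W)} (h : ∀ b ∈ S, IsLine (pushSubmodule (toAway B b) N)) :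
    IsLine N := by
  let e := Module.finBasis F W
  refine IsLine.of_span_eq_top (fun φ x hx y hy ↦ ?_) ?_
  · rw [← sub_eq_zero]
    refine eq_zero_of_local hS fun b hb ↦ ?_
    rw [map_sub, push_smul, push_smul, ← pushDual_push, ← pushDual_push, sub_eq_zero]
    exact (h b hb).swap _ (push_mem_pushSubmodule _ hx) (push_mem_pushSubmodule _ hy)
  · set J := Ideal.span {r | ∃ φ : Module.Dual B (B ⊗[F] W), ∃ v ∈ N, φ v = r} with hJ
    rw [Ideal.eq_top_iff_one]
    refine Submodule.mem_of_span_eq_top_of_smul_pow_mem J S hS 1 fun ⟨b, hb⟩ ↦ ?_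
    have key : J.map (toAway B b).hom = ⊤ := by
      rw [eq_top_iff, ← (h b hb).span_eq_top, Ideal.span_le]
      rintro _ ⟨φ, v, hv, rfl⟩
      induction hv using Submodule.span_induction with
      | zero => simp
      | add x y _ _ hx hy => rw [map_add]; exact Ideal.add_mem _ hx hy
      | smul c x _ hx => rw [map_smul]; exact Ideal.mul_mem_left _ _ hx
      | mem y hy =>
        obtain ⟨x, hx, rfl⟩ := hy
        -- A linear form over the localisation need not come from `B`, but its value is a
        -- combination of the coordinates of the vector, and those are values of forms defined over
        -- `B`.
        rw [← (e.baseChange _).sum_repr (push W (toAway B b) x), map_sum]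
        refine Ideal.sum_mem _ fun i _ ↦ ?_
        rw [map_smul, push_repr, smul_eq_mul]
        exact Ideal.mul_mem_right _ _ (Ideal.mem_map_of_mem _ (Ideal.subset_span
          ⟨(e.baseChange B).coord i, x, hx, rfl⟩))
    obtain ⟨n, hn⟩ := exists_pow_mem_of_map_eq_top key
    exact ⟨n, by simpa using hn⟩

end Localisation

/-! ### Gluing local linear automorphisms to a point of `PGL(W)`. -/

section Gluing

variable {F : Type u} [Field F] {W : Type u} [AddCommGroup W] [Module F W]
  {A : CommAlgCat.{u} F}

/-- Two natural families on `ℙ(W)` that agree Zariski locally are equal. -/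
theorem Family.eq_of_local [FiniteDimensional F W] {f f' : Family (projSpace F W) A}
    (hf : f.IsNatural) (hf' : f'.IsNatural) {S : Set A} (hS : Ideal.span S = ⊤)
    (h : ∀ a ∈ S, f.res (toAway A a) = f'.res (toAway A a)) : f = f' := by
  funext B k
  refine Equiv.ext fun L ↦ Subtype.ext (Veronese.eq_of_local (span_image_eq_top k hS) ?_)
  rintro _ ⟨a, ha, rfl⟩
  -- The localisation of `B` at the image of `a` is an algebra over `A[1/a]`, where the two families
  -- agree.
  obtain ⟨l, hl⟩ := toAway_lift (k ≫ toAway B (k.hom a)) (a := a) (toAway_isUnit (k.hom a))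
  have e : f _ (k ≫ toAway B (k.hom a)) = f' _ (k ≫ toAway B (k.hom a)) := by
    rw [← hl]
    exact congrFun (congrFun (h a ha) _) l
  have h1 := hf _ _ k (toAway B (k.hom a)) L
  have h2 := hf' _ _ k (toAway B (k.hom a)) L
  rw [e] at h1
  exact congrArg Subtype.val (h1.symm.trans h2)

/-- Linear automorphisms of `C ⊗ W` for varying `A`-algebras `C`, stable under base change, with
well-defined action on lines, and existing Zariski locally on `Spec A`. -/
structure GluingDatum (W : Type u) [AddCommGroup W] [Module F W] (A : CommAlgCat.{u} F) where
  /-- The linear automorphisms of `C ⊗ W` belonging to the datum. -/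
  carrier : ∀ C : CommAlgCat.{u} F, (A ⟶ C) → Set (GLPoints W C)
  map_mem : ∀ {C D : CommAlgCat.{u} F} (k : A ⟶ C) (l : C ⟶ D) (g : GLPoints W C),
    g ∈ carrier C k → GLPoints.map W l g ∈ carrier D (k ≫ l)
  glAction_eq : ∀ {C : CommAlgCat.{u} F} (k : A ⟶ C) (g g' : GLPoints W C),
    g ∈ carrier C k → g' ∈ carrier C k → glAction C g = glAction C g'
  span_eq_top : Ideal.span {a : A | (carrier _ (toAway A a)).Nonempty} = ⊤

namespace GluingDatum

variable (T : GluingDatum W A) {B C D : CommAlgCat.{u} F} (h : A ⟶ B)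

theorem span_eq_top' : Ideal.span {b : B | (T.carrier _ (h ≫ toAway B b)).Nonempty} = ⊤ := by
  rw [eq_top_iff, ← span_image_eq_top h T.span_eq_top]
  refine Ideal.span_mono ?_
  rintro _ ⟨a, ⟨g, hg⟩, rfl⟩
  obtain ⟨l, hl⟩ := toAway_lift (h ≫ toAway B (h.hom a)) (a := a) (toAway_isUnit (h.hom a))
  exact ⟨GLPoints.map W l g, hl ▸ T.map_mem _ l g hg⟩

theorem lineAction_eq {k : A ⟶ C} {g g' : GLPoints W C} (hg : g ∈ T.carrier C k)
    (hg' : g' ∈ T.carrier C k) {L : Submodule C (C ⊗[F] W)} (hL : IsLine L) :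
    L.map g.1 = L.map g'.1 := by
  have h1 := congrFun (congrFun (T.glAction_eq k g g' hg hg') C) (𝟙 C)
  have h3 : lineAction C g = lineAction C g' := by
    rw [← GLPoints.map_id g, ← GLPoints.map_id g']; exact h1
  exact congrArg Subtype.val (Equiv.congr_fun h3 ⟨L, hL⟩)

/-- The submodule glued from the images of `L` under the elements of the datum. -/
def glue (L : Submodule B (B ⊗[F] W)) : Submodule B (B ⊗[F] W) where
  carrier := {x | ∀ (C : CommAlgCat.{u} F) (k : B ⟶ C), ∀ g ∈ T.carrier C (h ≫ k),
    push W k x ∈ (pushSubmodule k L).map g.1}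
  zero_mem' C k g _ := by rw [map_zero]; exact zero_mem _
  add_mem' hx hy C k g hg := by
    rw [map_add]; exact Submodule.add_mem _ (hx C k g hg) (hy C k g hg)
  smul_mem' c x hx C k g hg := by
    rw [push_smul]; exact Submodule.smul_mem _ _ (hx C k g hg)

variable {h} {L : Submodule B (B ⊗[F] W)}

/-- The cocycle condition: base changing the image of `L` computed over `C` gives the image computed
over `D` by any member of the datum there. -/
theorem pushSubmodule_map_eq (hL : IsLine L) {k : B ⟶ C} {l : C ⟶ D} {g : GLPoints W C}
    {g' : GLPoints W D} (hg : g ∈ T.carrier C (h ≫ k)) (hg' : g' ∈ T.carrier D (h ≫ k ≫ l)) :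
    pushSubmodule l ((pushSubmodule k L).map g.1) = (pushSubmodule (k ≫ l) L).map g'.1 := by
  rw [pushSubmodule_map, ← pushSubmodule_comp]
  refine T.lineAction_eq (k := h ≫ k ≫ l) ?_ hg' (isLine_pushSubmodule _ hL)
  rw [← Category.assoc]
  exact T.map_mem _ _ _ hg

/-- The datum of inverses. -/
def inverse (T : GluingDatum W A) : GluingDatum W A where
  carrier C k := {g | g⁻¹ ∈ T.carrier C k}
  map_mem k l g hg := by
    change (GLPoints.map W l g)⁻¹ ∈ T.carrier _ _
    rw [← map_inv]
    exact T.map_mem k l _ hg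
  glAction_eq k g g' hg hg' := by
    rw [← inv_inj, ← map_inv, ← map_inv]
    exact T.glAction_eq k _ _ hg hg'
  span_eq_top := by
    rw [eq_top_iff, ← T.span_eq_top]
    refine Ideal.span_mono ?_
    rintro a ⟨g, hg⟩
    exact ⟨g⁻¹, by simpa using hg⟩

theorem inverse_inverse : T.inverse.inverse = T := by
  obtain ⟨c, _, _, _⟩ := T
  simp [inverse]

variable [FiniteDimensional F W]

/-- Membership in `glue` is a condition over all `B`-algebras at once; by the cocycle condition a
single trivialising cover of `Spec B` is enough to test it. -/
theorem mem_glue_of_local (hL : IsLine L) {S : Set B} (hS : Ideal.span S = ⊤)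
    (hST : ∀ b ∈ S, (T.carrier _ (h ≫ toAway B b)).Nonempty) {x : B ⊗[F] W}
    (hx : ∀ b ∈ S, ∀ g ∈ T.carrier _ (h ≫ toAway B b),
      push W (toAway B b) x ∈ (pushSubmodule (toAway B b) L).map g.1) : x ∈ T.glue h L := by
  intro C k g hg
  refine mem_of_local (span_image_eq_top k hS) ?_
  rintro _ ⟨b, hb, rfl⟩
  obtain ⟨gb, hgb⟩ := hST b hb
  obtain ⟨l, hl⟩ := toAway_lift (k ≫ toAway C (k.hom b)) (a := b) (toAway_isUnit (k.hom b))
  have hm : GLPoints.map W (toAway C (k.hom b)) g ∈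
      T.carrier _ (h ≫ k ≫ toAway C (k.hom b)) := by
    rw [← Category.assoc]; exact T.map_mem _ _ _ hg
  rw [T.pushSubmodule_map_eq hL hg hm, ← push_comp]
  revert hm
  generalize GLPoints.map W (toAway C (k.hom b)) g = g'
  -- This localisation of `C` is now viewed as an algebra over `B[1/b]`, so that the hypothesis on
  -- that chart applies.
  rw [← hl]
  intro hm
  rw [← T.pushSubmodule_map_eq hL hgb hm, push_comp]
  exact push_mem_pushSubmodule _ (hx b hb gb hgb)

/-- The point is to extend a local section `y` of the image to a global one after multiplication by
a power of `b`. Clear denominators to reach `x` over `B`; on every chart of a finite cover, some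
power of `b` times `x` lies in the image, by comparison on the overlap with `D(b)`; finally divide
by the unit `b`. -/
theorem pushSubmodule_glue_away (hL : IsLine L) {b : B}
    {g : GLPoints W (CommAlgCat.of F (Localization.Away b))}
    (hg : g ∈ T.carrier _ (h ≫ toAway B b)) :
    pushSubmodule (toAway B b) (T.glue h L) = (pushSubmodule (toAway B b) L).map g.1 := by
  refine le_antisymm (Submodule.span_le.2 ?_) fun y hy ↦ ?_
  · rintro _ ⟨x, hx, rfl⟩
    exact hx _ _ g hg
  classical
  obtain ⟨n, x, hx⟩ := push_toAway_surj b y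
  -- Finiteness of the cover is needed to choose one exponent of `b` for all charts.
  obtain ⟨S, hST, hS⟩ := (Ideal.span_eq_top_iff_finite _).1 (T.span_eq_top' h)
  have key : ∀ b' ∈ S, ∃ m : ℕ, ∀ g' ∈ T.carrier _ (h ≫ toAway B b'),
      push W (toAway B b') (b ^ m • x) ∈ (pushSubmodule (toAway B b') L).map g'.1 := by
    intro b' hb'
    obtain ⟨gb, hgb⟩ := hST hb'
    set β := (toAway B b').hom b with hβ
    obtain ⟨l, hl⟩ := toAway_lift (toAway B b' ≫ toAway _ β) (a := b) (toAway_isUnit β)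
    have hm : GLPoints.map W (toAway _ β) gb ∈ T.carrier _ (h ≫ toAway B b' ≫ toAway _ β) := by
      rw [← Category.assoc]; exact T.map_mem _ _ _ hgb
    have : push W (toAway _ β) (push W (toAway B b') x) ∈
        pushSubmodule (toAway _ β) ((pushSubmodule (toAway B b') L).map gb.1) := by
      rw [T.pushSubmodule_map_eq hL hgb hm, ← push_comp]
      revert hm
      generalize GLPoints.map W (toAway _ β) gb = g'
      rw [← hl]
      intro hm
      rw [← T.pushSubmodule_map_eq hL hg hm, push_comp, ← hx]
      exact push_mem_pushSubmodule _ (Submodule.smul_mem _ _ hy)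
    obtain ⟨m, hm⟩ := exists_pow_smul_mem this
    refine ⟨m, fun g' hg' ↦ ?_⟩
    rw [T.lineAction_eq hg' hgb (isLine_pushSubmodule _ hL), push_smul, map_pow]
    exact hm
  choose! m hm using key
  -- The sum of the exponents dominates each of them.
  have hmem : b ^ (∑ b' ∈ S, m b') • x ∈ T.glue h L := by
    refine T.mem_glue_of_local hL hS (fun b' hb' ↦ hST hb') fun b' hb' g' hg' ↦ ?_
    rw [← Finset.add_sum_erase _ _ hb', add_comm, pow_add, mul_smul, push_smul]
    exact Submodule.smul_mem _ _ (hm b' hb' g' hg')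
  have hu : IsUnit ((toAway B b).hom b ^ (∑ b' ∈ S, m b' + n)) := (toAway_isUnit b).pow _
  rw [← Submodule.smul_mem_iff_of_isUnit _ hu, pow_add, mul_smul, hx, ← map_pow, ← push_smul]
  exact push_mem_pushSubmodule _ hmem

/-- Arbitrary base change reduces to the previous case on the charts of `C` induced from a
trivialising cover of `Spec B`. -/
theorem pushSubmodule_glue (hL : IsLine L) (k : B ⟶ C) {g : GLPoints W C}
    (hg : g ∈ T.carrier _ (h ≫ k)) :
    pushSubmodule k (T.glue h L) = (pushSubmodule k L).map g.1 := by
  refine eq_of_local (span_image_eq_top k (T.span_eq_top' h)) ?_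
  rintro _ ⟨b, ⟨gb, hgb⟩, rfl⟩
  obtain ⟨l, hl⟩ := toAway_lift (k ≫ toAway C (k.hom b)) (a := b) (toAway_isUnit (k.hom b))
  have hm : GLPoints.map W (toAway C (k.hom b)) g ∈
      T.carrier _ (h ≫ k ≫ toAway C (k.hom b)) := by
    rw [← Category.assoc]; exact T.map_mem _ _ _ hg
  rw [T.pushSubmodule_map_eq hL hg hm, ← pushSubmodule_comp]
  revert hm
  generalize GLPoints.map W (toAway C (k.hom b)) g = g'
  rw [← hl]
  intro hm
  rw [← T.pushSubmodule_map_eq hL hgb hm, pushSubmodule_comp, T.pushSubmodule_glue_away hL hgb]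

theorem isLine_glue (hL : IsLine L) : IsLine (T.glue h L) := by
  refine isLine_of_local (T.span_eq_top' h) ?_
  rintro b ⟨g, hg⟩
  rw [T.pushSubmodule_glue_away hL hg]
  exact isLine_map g (isLine_pushSubmodule _ hL)

theorem glue_inverse_glue (hL : IsLine L) : T.inverse.glue h (T.glue h L) = L := by
  refine eq_of_local (T.span_eq_top' h) ?_
  rintro b ⟨g, hg⟩
  have hg' : g⁻¹ ∈ T.inverse.carrier _ (h ≫ toAway B b) := by
    change g⁻¹⁻¹ ∈ T.carrier _ _
    rwa [inv_inv]
  rw [T.inverse.pushSubmodule_glue (T.isLine_glue hL) _ hg', T.pushSubmodule_glue hL _ hg,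
    ← Submodule.map_comp, ← Module.End.mul_eq_comp, ← Units.val_mul, inv_mul_cancel]
  exact Submodule.map_id _

/-- The family of permutations glued from the datum. -/
def family : Family (projSpace F W) A := fun B h ↦
  { toFun := fun L ↦ ⟨T.glue h L.1, T.isLine_glue L.2⟩
    invFun := fun L ↦ ⟨T.inverse.glue h L.1, T.inverse.isLine_glue L.2⟩
    left_inv := fun L ↦ Subtype.ext (T.glue_inverse_glue L.2)
    right_inv := fun L ↦ Subtype.ext (by
      have := T.inverse.glue_inverse_glue (h := h) L.2
      rwa [inverse_inverse] at this) }

theorem family_res (k : A ⟶ C) {g : GLPoints W C} (hg : g ∈ T.carrier C k) :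
    T.family.res k = glAction C g := by
  funext D l
  refine Equiv.ext fun L ↦ Subtype.ext ?_
  change T.glue (k ≫ l) L.1 = L.1.map (GLPoints.map W l g).1
  have := T.pushSubmodule_glue (h := k ≫ l) L.2 (𝟙 D) (g := GLPoints.map W l g)
    (by rw [Category.comp_id]; exact T.map_mem _ _ _ hg)
  rwa [pushSubmodule_id, pushSubmodule_id] at this

theorem family_isNatural : T.family.IsNatural := by
  intro B C h k L
  refine Subtype.ext ?_
  change T.glue (h ≫ k) (pushSubmodule k L.1) = pushSubmodule k (T.glue h L.1)
  refine eq_of_local (T.span_eq_top' (h ≫ k)) ?_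
  rintro c ⟨g, hg⟩
  rw [T.pushSubmodule_glue (isLine_pushSubmodule _ L.2) _ hg, ← pushSubmodule_comp,
    ← pushSubmodule_comp, T.pushSubmodule_glue L.2 (k ≫ toAway C c) (g := g)]
  rwa [← Category.assoc]

theorem family_mem_PGL : T.family ∈ (PGL F W).points A := by
  refine ⟨T.family_isNatural, ?_⟩
  rw [eq_top_iff, ← T.span_eq_top]
  refine Ideal.span_mono ?_
  rintro a ⟨g, hg⟩
  exact ⟨g, T.family_res _ hg⟩

end GluingDatum

end Gluing

/-! ### Contraction of divided powers against powers of linear forms. -/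

section Contraction

variable {R : Type u} [CommRing R] (n : ℕ) {M : Type u} [AddCommGroup M] [Module R M]

/-- The linear map `Γⁿ⁺¹(M) → M` with `[v] ↦ φ(v)ⁿ • v`. -/
noncomputable def powContract (φ : Module.Dual R M) : Gamma R (n + 1) M →ₗ[R] M :=
  PiTensorProduct.lift (LinearMap.uncurryLeft (M := fun _ : Fin (n + 1) ↦ M)
    { toFun := fun x ↦
        ((MultilinearMap.mkPiAlgebra R (Fin n) R).compLinearMap fun _ ↦ φ).smulRight x
      map_add' := fun x y ↦ by ext; simp
      map_smul' := fun c x ↦ by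
        ext
        simp only [MultilinearMap.smulRight_apply, _root_.smul_apply, RingHom.id_apply]
        exact smul_comm _ _ _ }) ∘ₗ (Gamma R (n + 1) M).subtype

theorem powContract_symbol (φ : Module.Dual R M) (v : M) :
    powContract n φ (symbol R (n + 1) v) = φ v ^ n • v := by
  simp [powContract, symbol, Fin.tail]

end Contraction

/-! ### Injectivity and equivariance of the Veronese map; base change of `Γⁿ(g)`. -/

section VeroneseMap

variable {F : Type u} [Field F] {n : ℕ} {V : Type u} [AddCommGroup V] [Module F V]
  {A B C : CommAlgCat.{u} F}

/-- Contracting `[v]` with `φ` yields `φ(v)ⁿ⁻¹ • v`, so these multiples of vectors of `L` lie in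
`L'`. The `n`-th powers of the pairings in a frame of `L` still generate the unit ideal, and the
swap relation then writes every element of `L` in terms of such multiples. -/
theorem le_of_symbolSpan_le (hn : 1 ≤ n) {L L' : Submodule B (B ⊗[F] V)} (hL : IsLine L)
    (h : symbolSpan n L ≤ symbolSpan n L') : L ≤ L' := by
  obtain ⟨n, rfl⟩ : ∃ m, n = m + 1 := ⟨n - 1, by omega⟩
  have key : ∀ (φ : Module.Dual B (B ⊗[F] V)), ∀ v ∈ L, φ v ^ n • v ∈ L' := by
    intro φ v hv
    have h1 : ∀ z ∈ symbolSpan (n + 1) L',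
        powContract n φ (gammaBaseChange (n + 1) V B z) ∈ L' := by
      intro z hz
      induction hz using Submodule.span_induction with
      | zero => simp
      | add a b _ _ ha hb => simpa only [map_add] using L'.add_mem ha hb
      | smul c a _ ha => simpa only [map_smul] using L'.smul_mem c ha
      | mem z hz =>
        obtain ⟨x, hx, rfl⟩ := hz
        rw [gammaBaseChange_pureSymbol, powContract_symbol]
        exact L'.smul_mem _ hx
    have h2 := h1 _ (h (Submodule.subset_span ⟨v, hv, rfl⟩))
    rwa [gammaBaseChange_pureSymbol, powContract_symbol] at h2
  intro x hx
  obtain ⟨s, hv, h1, hsw⟩ := hL.exists_frame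
  obtain ⟨d, hd⟩ := exists_pow_frame (n + 1) s (fun i ↦ i.1 i.2) h1
  rw [← one_smul B x, ← hd, Finset.sum_smul]
  refine L'.sum_mem fun i hi ↦ ?_
  -- One of the `n + 1` factors `φ(v)` is spent on trading `x` for `v`.
  have : (d i * i.1 i.2 ^ (n + 1)) • x = (d i * i.1 x) • (i.1 i.2 ^ n • i.2) := by
    rw [pow_succ, ← mul_assoc, mul_smul, hsw i hi _ (hv i hi) _ hx, smul_smul, smul_smul]
    congr 1
    ring
  rw [this]
  exact L'.smul_mem _ (key _ _ (hv i hi))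

theorem symbolSpan_injective (hn : 1 ≤ n) {L L' : Submodule B (B ⊗[F] V)} (hL : IsLine L)
    (hL' : IsLine L') (h : symbolSpan n L = symbolSpan n L') : L = L' :=
  le_antisymm (le_of_symbolSpan_le hn hL h.le) (le_of_symbolSpan_le hn hL' h.ge)

theorem symbolSpan_map (g : GLPoints V A) (L : Submodule A (A ⊗[F] V)) :
    symbolSpan n (L.map g.1) = (symbolSpan n L).map (glGamma n A g).1 := by
  rw [symbolSpan, symbolSpan, Submodule.map_span]
  congr 1
  ext x
  simp only [Set.mem_image, SetLike.mem_coe, Submodule.mem_map]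
  constructor
  · rintro ⟨_, ⟨y, hy, rfl⟩, rfl⟩
    exact ⟨_, ⟨y, hy, rfl⟩, glGamma_pureSymbol n g y⟩
  · rintro ⟨_, ⟨y, hy, rfl⟩, rfl⟩
    exact ⟨_, ⟨y, hy, rfl⟩, (glGamma_pureSymbol n g y).symm⟩

theorem symbolSpan_span_singleton (v : B ⊗[F] V) :
    symbolSpan n (Submodule.span B {v}) = Submodule.span B {pureSymbol n v} := by
  refine le_antisymm (Submodule.span_le.2 ?_) ((Submodule.span_singleton_le_iff_mem _ _).2
    (Submodule.subset_span ⟨v, Submodule.mem_span_singleton_self v, rfl⟩))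
  rintro _ ⟨y, hy, rfl⟩
  obtain ⟨b, rfl⟩ := Submodule.mem_span_singleton.1 hy
  rw [pureSymbol_smul]
  exact Submodule.smul_mem _ _ (Submodule.mem_span_singleton_self _)

/-- The inclusion of `B ⊗ Γⁿ(V)` in `B ⊗ V^{⊗ n}`. -/
noncomputable def gammaIncl (n : ℕ) (V : Type u) [AddCommGroup V] [Module F V]
    (B : CommAlgCat.{u} F) : B ⊗[F] Gamma F n V →ₗ[B] B ⊗[F] (⨂[F] _ : Fin n, V) :=
  (Gamma F n V).subtype.baseChange B

theorem tensorBaseChange_gammaIncl (z : B ⊗[F] Gamma F n V) :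
    tensorBaseChange n V B (gammaIncl n V B z) = (gammaBaseChange n V B z).1 := rfl

theorem gammaIncl_injective : Function.Injective (gammaIncl n V B) := fun x y h ↦
  (gammaBaseChange n V B).injective <| Subtype.ext <| by
    rw [← tensorBaseChange_gammaIncl, h, tensorBaseChange_gammaIncl]

theorem gammaIncl_push (k : B ⟶ C) (z : B ⊗[F] Gamma F n V) :
    gammaIncl n V C (push _ k z) = push _ k (gammaIncl n V B z) := by
  induction z with
  | zero => simp
  | add x y hx hy => simp only [map_add, hx, hy]
  | tmul b t => rfl

/-- The relation between `x` and `y` determines `y` linearly in terms of `x`, so the claim reduces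
to pure tensors, where everything is computed factor by factor. -/
theorem tensorBaseChange_push_map (k : A ⟶ C) (g : GLPoints V A)
    (x y : A ⊗[F] (⨂[F] _ : Fin n, V))
    (h : tensorBaseChange n V A y = PiTensorProduct.map (fun _ ↦ g.1) (tensorBaseChange n V A x)) :
    tensorBaseChange n V C (push _ k y) =
      PiTensorProduct.map (fun _ ↦ (GLPoints.map V k g).1)
        (tensorBaseChange n V C (push _ k x)) := by
  obtain rfl : y = (LinearEquiv.ofBijective _ (tensorBaseChange_bijective n V A)).symm
      (PiTensorProduct.map (fun _ ↦ g.1) (tensorBaseChange n V A x)) := by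
    rw [LinearEquiv.eq_symm_apply, LinearEquiv.ofBijective_apply, h]
  clear h
  induction x with
  | zero => simp
  | add x y hx hy => simp only [map_add, hx, hy]
  | tmul b t =>
    induction t using PiTensorProduct.induction_on with
    | add x y hx hy => simp only [TensorProduct.tmul_add, map_add, hx, hy]
    | smul_tprod r v =>
      rw [TensorProduct.tmul_smul, TensorProduct.smul_tmul', push_tmul, tensorBaseChange_tmul,
        tensorBaseChange_tmul, map_smul, map_smul (LinearEquiv.symm _), push_smul, map_smul, map_smul,
        map_smul (PiTensorProduct.map _), PiTensorProduct.map_tprod, PiTensorProduct.map_tprod,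
        tensorBaseChange_push n k (fun i ↦ g.1 (1 ⊗ₜ v i))]
      · congr 2
        funext i
        rw [← GLPoints.map_push]
        simp
      · exact LinearEquiv.apply_symm_apply
          (LinearEquiv.ofBijective _ (tensorBaseChange_bijective n V A)) _

theorem glGamma_map (k : A ⟶ C) (g : GLPoints V A) :
    GLPoints.map _ k (glGamma n A g) = glGamma n C (GLPoints.map V k g) := by
  refine Units.ext (pushEnd_unique k _ _ fun x ↦ ?_).symm
  have h1 : ∀ {A : CommAlgCat.{u} F} (g : GLPoints V A) (x : A ⊗[F] Gamma F n V),
      tensorBaseChange n V A (gammaIncl n V A ((glGamma n A g).1 x)) =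
        PiTensorProduct.map (fun _ ↦ g.1) (tensorBaseChange n V A (gammaIncl n V A x)) := by
    intro A g x
    rw [tensorBaseChange_gammaIncl, tensorBaseChange_gammaIncl]
    change (gammaBaseChange n V A ((gammaBaseChange n V A).symm
      (gammaMap n g.1 (gammaBaseChange n V A x)))).1 = _
    rw [LinearEquiv.apply_symm_apply]
    rfl
  apply gammaIncl_injective
  apply (tensorBaseChange_bijective n V C).1
  rw [h1, gammaIncl_push, gammaIncl_push, tensorBaseChange_push_map k g _ _ (h1 g x)]

end VeroneseMap

/-! ### Coordinates on `Γⁿ(V)`, and linear forms as forms of degree `n`. -/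

section Coordinates

variable {F : Type u} [Field F] {n : ℕ} {V : Type u} [AddCommGroup V] [Module F V]
  {A B C : CommAlgCat.{u} F} {ι : Type} (e : Module.Basis ι F V)

/-- The coordinates of an element of `B ⊗ Γⁿ(V)` with respect to a basis of `V`. -/
noncomputable def gammaCoord (I : Fin n → ι) : Module.Dual B (B ⊗[F] Gamma F n V) :=
  ((Basis.piTensorProduct fun _ : Fin n ↦ e).baseChange B).coord I ∘ₗ gammaIncl n V B

theorem gammaCoord_push (k : B ⟶ C) (I : Fin n → ι) (z : B ⊗[F] Gamma F n V) :
    gammaCoord e I (push _ k z) = k.hom (gammaCoord e I z) := by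
  simp only [gammaCoord, LinearMap.comp_apply, gammaIncl_push, Module.Basis.coord_apply]
  exact push_repr _ _ _ _

theorem pushDual_gammaCoord (k : B ⟶ C) (I : Fin n → ι) :
    pushDual k (gammaCoord (B := B) e I) = gammaCoord e I := by
  refine TensorProduct.AlgebraTensorModule.curry_injective (LinearMap.ext_ring ?_)
  ext v
  have h1 := gammaCoord_push e k I (1 ⊗ₜ v)
  rw [← pushDual_push] at h1
  simpa using h1.symm

theorem reindex_repr (σ : Equiv.Perm (Fin n)) (t : ⨂[F] _ : Fin n, V) (I : Fin n → ι) :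
    (Basis.piTensorProduct fun _ : Fin n ↦ e).repr (PiTensorProduct.reindex F (fun _ ↦ V) σ t) I =
      (Basis.piTensorProduct fun _ : Fin n ↦ e).repr t (I ∘ σ) := by
  induction t using PiTensorProduct.induction_on with
  | add x y hx hy => simp only [map_add, Finsupp.add_apply, hx, hy]
  | smul_tprod r v =>
    rw [map_smul, PiTensorProduct.reindex_tprod, map_smul, map_smul, Finsupp.smul_apply,
      Finsupp.smul_apply, Basis.piTensorProduct_repr_tprod_apply,
      Basis.piTensorProduct_repr_tprod_apply, ← Equiv.prod_comp σ]
    refine congrArg (r • ·) (Finset.prod_congr rfl fun i _ ↦ ?_)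
    exact congrArg (fun j ↦ e.repr (v j) (I (σ i))) (σ.symm_apply_apply i)

theorem exists_perm_of_card_fiber {κ : Type*} [DecidableEq κ] (I J : Fin n → κ)
    (h : ∀ o, Fintype.card {k // I k = o} = Fintype.card {k // J k = o}) :
    ∃ σ : Equiv.Perm (Fin n), J ∘ σ = I := by
  let E : ∀ o, {k // I k = o} ≃ {k // J k = o} := fun o ↦ Fintype.equivOfCardEq (h o)
  refine ⟨(Equiv.sigmaFiberEquiv I).symm.trans ((Equiv.sigmaCongrRight E).trans
    (Equiv.sigmaFiberEquiv J)), funext fun k ↦ ?_⟩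
  exact (E (I k) ⟨k, rfl⟩).2

/-- Two words with the same multiplicities differ by a permutation of the positions, and the tensor
is invariant. Thus the coefficients of a symmetric tensor depend only on the multidegree. -/
theorem repr_gamma_eq [DecidableEq ι] (s : Gamma F n V) {I J : Fin n → ι}
    (h : ∀ o, Fintype.card {k // I k = o} = Fintype.card {k // J k = o}) :
    (Basis.piTensorProduct fun _ : Fin n ↦ e).repr s.1 I =
      (Basis.piTensorProduct fun _ : Fin n ↦ e).repr s.1 J := by
  obtain ⟨σ, rfl⟩ := exists_perm_of_card_fiber I J h
  conv_rhs => rw [← s.2 σ]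
  rw [reindex_repr]

variable [Fintype ι]

/-- The vector of `B ⊗ V` with given coordinates. -/
noncomputable def vec (c : ι → B) : B ⊗[F] V := ∑ o, c o ⊗ₜ e o

theorem vec_repr (x : B ⊗[F] V) : vec e (fun o ↦ (e.baseChange B).repr x o) = x := by
  conv_rhs => rw [← (e.baseChange B).sum_repr x]
  simp [vec, TensorProduct.smul_tmul']

theorem repr_vec [DecidableEq ι] (c : ι → B) (o : ι) : (e.baseChange B).repr (vec e c) o = c o := by
  simp [vec, Finsupp.single_apply]

theorem smul_vec (b : B) (c : ι → B) : b • vec e c = vec e (fun o ↦ b * c o) := by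
  simp [vec, Finset.smul_sum, TensorProduct.smul_tmul']

theorem push_vec (k : B ⟶ C) (c : ι → B) : push V k (vec e c) = vec e (fun o ↦ k.hom (c o)) := by
  simp [vec]

theorem gammaIncl_pureSymbol [DecidableEq ι] (c : ι → B) :
    gammaIncl n V B (pureSymbol n (vec e c)) =
      ∑ I : Fin n → ι, (∏ j, c (I j)) ⊗ₜ (⨂ₜ[F] j, e (I j)) := by
  apply (tensorBaseChange_bijective n V B).1
  rw [tensorBaseChange_gammaIncl, gammaBaseChange_pureSymbol, map_sum]
  simp_rw [← tprod_tmul]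
  change PiTensorProduct.tprod B (fun _ : Fin n ↦ vec e c) = _
  simp only [vec, MultilinearMap.map_sum]

theorem gammaCoord_pureSymbol [DecidableEq ι] (I : Fin n → ι) (c : ι → B) :
    gammaCoord e I (pureSymbol n (vec e c)) = ∏ j, c (I j) := by
  rw [gammaCoord, LinearMap.comp_apply, gammaIncl_pureSymbol, map_sum,
    Finset.sum_eq_single I]
  · simp
  · intro J _ hJ
    rw [← Basis.piTensorProduct_apply (fun _ : Fin n ↦ e) J, Module.Basis.coord_apply,
      Module.Basis.baseChange_repr_tmul, Module.Basis.repr_self, Finsupp.single_eq_of_ne hJ.symm,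
      zero_smul]
  · simp

/-- Linear forms on `A ⊗ Γⁿ(V)` are homogeneous forms of degree `n` in the coordinates of `V`. -/
theorem exists_form (φ : Module.Dual A (A ⊗[F] Gamma F n V)) :
    ∃ q : (Fin n → ι) → A, φ = ∑ I, q I • gammaCoord e I := by
  classical
  -- As `F` is a field, the form extends from `Γⁿ(V)` to the whole tensor power. The coefficients
  -- `q` are the values of an extension on basis tensors, and are not unique.
  obtain ⟨ψ, hψ⟩ := LinearMap.exists_extend
    (φ.restrictScalars F ∘ₗ TensorProduct.mk F A (Gamma F n V) 1)
  refine ⟨fun I ↦ ψ (⨂ₜ[F] j, e (I j)), ?_⟩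
  refine TensorProduct.AlgebraTensorModule.curry_injective (LinearMap.ext_ring ?_)
  ext s
  have h1 := LinearMap.congr_fun hψ s
  have h2 : ψ s.1 = _ := congrArg ψ ((Basis.piTensorProduct fun _ : Fin n ↦ e).sum_repr s.1).symm
  simp only [LinearMap.comp_apply, Submodule.subtype_apply, LinearMap.restrictScalars_apply,
    TensorProduct.mk_apply] at h1
  simp only [TensorProduct.AlgebraTensorModule.curry_apply, LinearMap.restrictScalars_apply,
    TensorProduct.curry_apply, ← h1, h2, map_sum, map_smul, LinearMap.sum_apply,
    LinearMap.smul_apply, Basis.piTensorProduct_apply]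
  refine Finset.sum_congr rfl fun I _ ↦ ?_
  simp [gammaCoord, gammaIncl, Algebra.smul_def, mul_comm]

theorem pushDual_sum_gammaCoord (k : A ⟶ C) (q : (Fin n → ι) → A) :
    pushDual k (∑ I, q I • gammaCoord (B := A) e I) =
      ∑ I, k.hom (q I) • gammaCoord (B := C) e I := by
  refine TensorProduct.AlgebraTensorModule.curry_injective (LinearMap.ext_ring ?_)
  ext v
  have h1 := pushDual_push k (∑ I, q I • gammaCoord (B := A) e I) (1 ⊗ₜ v)
  have h2 : ∀ I : Fin n → ι, k.hom (gammaCoord (B := A) e I (1 ⊗ₜ v)) =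
      gammaCoord (B := C) e I (1 ⊗ₜ v) := fun I ↦ by
    rw [← gammaCoord_push]; simp
  simpa [h2] using h1

theorem pushDual_comp_pushEnd {W : Type u} [AddCommGroup W] [Module F W] (k : A ⟶ C)
    (φ : Module.Dual A (A ⊗[F] W)) (g : Module.End A (A ⊗[F] W)) :
    pushDual k (φ ∘ₗ g) = pushDual k φ ∘ₗ pushEnd k g := by
  refine TensorProduct.AlgebraTensorModule.curry_injective (LinearMap.ext_ring ?_)
  ext v
  have h1 := pushDual_push k (φ ∘ₗ g) (1 ⊗ₜ v)
  rw [LinearMap.comp_apply, ← pushDual_push, ← pushEnd_push] at h1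
  simpa using h1

end Coordinates

/-! ### Formal transformations with bounded degree are homographies. -/

section PowerSeries

open MvPowerSeries

variable {R : Type u} [CommRing R] {σ : Type} {n : ℕ}

theorem exists_eq_single_of_degree_eq_one {d : σ →₀ ℕ} (h : d.degree = 1) :
    ∃ i, d = Finsupp.single i 1 := by
  classical
  have h0 : d ≠ 0 := by rintro rfl; simp at h
  obtain ⟨i, hi⟩ := Finsupp.ne_iff.1 h0
  have hle : Finsupp.single i 1 ≤ d := by
    rw [Finsupp.single_le_iff]
    exact Nat.one_le_iff_ne_zero.2 hi
  refine ⟨i, ?_⟩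
  have h1 : d - Finsupp.single i 1 = 0 := by
    rw [← Finsupp.degree_eq_zero_iff]
    have := congrArg Finsupp.degree (tsub_add_cancel_of_le hle)
    rw [map_add, Finsupp.degree_single, h] at this
    omega
  rw [← tsub_add_cancel_of_le hle, h1, zero_add]

theorem coeff_single_mul (j : σ) (p q : MvPowerSeries σ R) :
    coeff (Finsupp.single j 1) (p * q) =
      coeff (Finsupp.single j 1) p * constantCoeff q +
        constantCoeff p * coeff (Finsupp.single j 1) q := by
  classical
  rw [coeff_mul, Finsupp.antidiagonal_single]
  simp [Finset.Nat.antidiagonal_succ, add_comm]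

/-- The coordinates `(1, X)` of the generic vector in an affine chart. -/
noncomputable def gen (R : Type u) [CommRing R] : Option σ → MvPowerSeries σ R
  | none => 1
  | some i => X i

/-- The exponent of the monomial `∏ j, gen (I j)`. -/
noncomputable def cnt (I : Fin n → Option σ) : σ →₀ ℕ :=
  ∑ j, (I j).elim 0 fun i ↦ Finsupp.single i 1

theorem prod_gen (I : Fin n → Option σ) : ∏ j, gen R (I j) = monomial (cnt I) 1 := by
  have : ∀ s : Finset (Fin n), ∏ j ∈ s, gen R (I j) =
      monomial (∑ j ∈ s, (I j).elim 0 fun i ↦ Finsupp.single i 1) 1 := by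
    classical
    intro s
    induction s using Finset.induction_on with
    | empty => simp
    | insert a s ha ih =>
      rw [Finset.prod_insert ha, Finset.sum_insert ha, ih]
      cases I a with
      | none => simp [gen]
      | some i => simp [gen, X, monomial_mul_monomial]
  exact this _

theorem degree_cnt_le (I : Fin n → Option σ) : (cnt I).degree ≤ n := by
  rw [cnt, map_sum]
  refine (Finset.sum_le_card_nsmul _ _ 1 fun j _ ↦ ?_).trans (by simp)
  cases I j <;> simp

theorem cnt_apply [DecidableEq σ] (I : Fin n → Option σ) (i : σ) :
    cnt I i = Fintype.card {j // I j = some i} := by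
  rw [cnt, Finsupp.finsetSum_apply, Fintype.card_subtype, Finset.card_filter]
  refine Finset.sum_congr rfl fun j _ ↦ ?_
  cases h : I j with
  | none => simp
  | some k => simp [Finsupp.single_apply]

theorem card_fiber_eq_of_cnt_eq [DecidableEq σ] [Fintype σ] {I J : Fin n → Option σ}
    (h : cnt I = cnt J) (o : Option σ) :
    Fintype.card {j // I j = o} = Fintype.card {j // J j = o} := by
  have h1 : ∀ i, Fintype.card {j // I j = some i} = Fintype.card {j // J j = some i} := fun i ↦ by
    rw [← cnt_apply, h, cnt_apply]
  cases o with
  | some i => exact h1 i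
  | none =>
    -- The exponent forgets the letter `none`, but its multiplicity is recovered as `n` minus the
    -- others.
    have h2 : ∀ I : Fin n → Option σ, Fintype.card {j // I j = none} +
        ∑ i, Fintype.card {j // I j = some i} = n := fun I ↦ by
      rw [← Fintype.sum_option fun o ↦ Fintype.card {j // I j = o}, ← Fintype.card_sigma,
        Fintype.card_congr (Equiv.sigmaFiberEquiv I), Fintype.card_fin]
    have h3 := h2 I
    have h4 := h2 J
    rw [Finset.sum_congr rfl fun i _ ↦ h1 i] at h3
    omega

theorem coeff_form [Fintype σ] [DecidableEq σ] (q : (Fin n → Option σ) → R) (d : σ →₀ ℕ) :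
    coeff d (∑ I, C (q I) * ∏ j, gen R (I j)) = ∑ I with cnt I = d, q I := by
  rw [map_sum, Finset.sum_filter]
  refine Finset.sum_congr rfl fun I _ ↦ ?_
  rw [prod_gen, coeff_C_mul, coeff_monomial]
  simp [eq_comm]

/-- Dehomogenising a form of degree `n` gives a polynomial of degree at most `n`. This bound is the
constraint that linearity of `g` puts on its formal transformation. -/
theorem coeff_form_eq_zero [Fintype σ] (q : (Fin n → Option σ) → R) {d : σ →₀ ℕ}
    (hd : n < d.degree) : coeff d (∑ I, C (q I) * ∏ j, gen R (I j)) = 0 := by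
  classical
  rw [coeff_form, Finset.filter_eq_empty_iff.2, Finset.sum_empty]
  rintro I - rfl
  exact absurd (degree_cnt_le I) (not_le.2 hd)

/-- Replace the factors `W` by `X` one at a time: each factor has order at least one, and each
replacement gains one more order. The two bounds are carried through the induction together. -/
theorem natCast_le_order_prod_sub {κ : Type*} {W : σ → MvPowerSeries σ R}
    (h : ∀ i, 2 ≤ (W i - X i).order) (I : κ → σ) (s : Finset κ) :
    ((s.card : ℕ∞) ≤ (∏ j ∈ s, W (I j)).order) ∧
      ((s.card + 1 : ℕ∞) ≤ (∏ j ∈ s, W (I j) - ∏ j ∈ s, X (I j)).order) := by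
  classical
  have hX : ∀ i : σ, 1 ≤ (X i : MvPowerSeries σ R).order := fun i ↦
    one_le_order_iff_constCoeff_eq_zero.2 (constantCoeff_X i)
  have hW : ∀ i : σ, 1 ≤ (W i).order := fun i ↦ by
    rw [← sub_add_cancel (W i) (X i)]
    exact (le_min (le_trans (by norm_num) (h i)) (hX i)).trans min_order_le_add
  induction s using Finset.induction_on with
  | empty => simp
  | insert a s ha ih =>
    rw [Finset.prod_insert ha, Finset.prod_insert ha, Finset.card_insert_of_notMem ha]
    push_cast
    refine ⟨?_, ?_⟩
    · rw [add_comm]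
      exact (add_le_add (hW _) ih.1).trans le_order_mul
    · have e : W (I a) * ∏ j ∈ s, W (I j) - X (I a) * ∏ j ∈ s, X (I j) =
          (W (I a) - X (I a)) * ∏ j ∈ s, W (I j) +
            X (I a) * (∏ j ∈ s, W (I j) - ∏ j ∈ s, X (I j)) := by ring
      rw [e]
      refine (le_min ?_ ?_).trans min_order_le_add
      · refine le_trans ?_ ((add_le_add (h _) ih.1).trans le_order_mul)
        rw [add_assoc, add_comm]
        norm_num
      · refine le_trans ?_ ((add_le_add (hX _) ih.2).trans le_order_mul)
        rw [add_comm]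

/-- The right side is the leading term, of degree `n`, and the two sides differ only in degrees
above `n`; there the left side vanishes by hypothesis. -/
theorem mul_prod_eq_of_degree_le {u : MvPowerSeries σ R} {W : σ → MvPowerSeries σ R}
    (h : ∀ i, 2 ≤ (W i - X i).order) (I : Fin n → σ)
    (hd : ∀ d : σ →₀ ℕ, n < d.degree → coeff d (u * ∏ j, W (I j)) = 0) :
    u * ∏ j, W (I j) = C (constantCoeff u) * ∏ j, X (I j) := by
  classical
  have hX : ∏ j, (X (I j) : MvPowerSeries σ R) = monomial (cnt fun j ↦ some (I j)) 1 := by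
    rw [← prod_gen]; rfl
  have hord : (n + 1 : ℕ∞) ≤ (u * ∏ j, W (I j) - C (constantCoeff u) * ∏ j, X (I j)).order := by
    obtain ⟨h1, h2⟩ := natCast_le_order_prod_sub h I Finset.univ
    rw [Finset.card_univ, Fintype.card_fin] at h1 h2
    have e : u * ∏ j, W (I j) - C (constantCoeff u) * ∏ j, X (I j) =
        (u - C (constantCoeff u)) * ∏ j, W (I j) +
          C (constantCoeff u) * (∏ j, W (I j) - ∏ j, X (I j)) := by ring
    have hu : 1 ≤ (u - C (constantCoeff u)).order :=
      one_le_order_iff_constCoeff_eq_zero.2 (by simp)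
    rw [e]
    refine (le_min ?_ ?_).trans min_order_le_add
    · refine le_trans ?_ ((add_le_add hu h1).trans le_order_mul)
      rw [add_comm]
    · refine le_trans ?_ ((add_le_add (zero_le (a := (C (constantCoeff u)).order)) h2).trans
        le_order_mul)
      rw [zero_add]
  ext d
  rcases lt_or_ge n d.degree with hlt | hle
  · rw [hd d hlt, hX, coeff_C_mul, coeff_monomial, if_neg, mul_zero]
    rintro rfl
    exact absurd (degree_cnt_le _) (not_le.2 hlt)
  · rw [← sub_eq_zero, ← map_sub]
    refine coeff_of_lt_order (lt_of_lt_of_le ?_ hord)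
    exact_mod_cast Nat.lt_succ_of_le hle

theorem eq_one_add_sum [Fintype σ] {p : MvPowerSeries σ R} (h0 : constantCoeff p = 1)
    (h : ∀ d : σ →₀ ℕ, 1 < d.degree → coeff d p = 0) :
    p = 1 + ∑ i, C (coeff (Finsupp.single i 1) p) * X i := by
  classical
  ext d
  rw [map_add, map_sum, coeff_one]
  simp_rw [coeff_C_mul, coeff_X]
  rcases Nat.lt_trichotomy d.degree 1 with hd | hd | hd
  · obtain rfl := (Finsupp.degree_eq_zero_iff d).1 (by omega)
    simp [h0, eq_comm (a := (0 : σ →₀ ℕ))]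
  · obtain ⟨i, rfl⟩ := exists_eq_single_of_degree_eq_one hd
    simp [Finsupp.single_left_inj]
  · rw [h d hd, if_neg (by rintro rfl; simp at hd), Finset.sum_eq_zero, add_zero]
    intro i _
    rw [if_neg (by rintro rfl; simp at hd), mul_zero]

/-- The ring `R` may have zero divisors, but multiplication by a power of a variable only shifts
coefficients. -/
theorem X_pow_mul_left_cancel (i : σ) (m : ℕ) {p q : MvPowerSeries σ R}
    (h : X i ^ m * p = X i ^ m * q) : p = q := by
  ext d
  have := congrArg (coeff (Finsupp.single i m + d)) h
  rwa [X_pow_eq, coeff_add_monomial_mul, coeff_add_monomial_mul, one_mul, one_mul] at this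

/-- A monomial of `W i` not involving `X i` is either constant, hence absent, or involves another
variable `X j`. Multiplied by `X j` it would occur in `X i * W j`, which is impossible. So `X i`
divides `W i`, and the relations propagate the quotient `s` to all `W j`. -/
theorem exists_common_factor {W : σ → MvPowerSeries σ R} (hW : ∀ i, 2 ≤ (W i - X i).order) (i : σ)
    (hcomm : ∀ j, X i * W j = X j * W i) :
    ∃ s, (∀ j, W j = X j * s) ∧ constantCoeff s = 1 := by
  classical
  have hW0 : constantCoeff (W i) = 0 := by
    have : constantCoeff (W i - X i) = 0 :=
      one_le_order_iff_constCoeff_eq_zero.1 (le_trans (by norm_num) (hW i))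
    simpa using this
  have hdvd : X i ∣ W i := by
    rw [X_dvd_iff]
    intro d hdi
    by_cases h0 : d = 0
    · rw [h0]; exact hW0
    obtain ⟨j, hj⟩ := Finsupp.ne_iff.1 h0
    have h2 := congrArg (coeff (Finsupp.single j 1 + d)) (hcomm j)
    rw [X, X, coeff_add_monomial_mul, one_mul, coeff_monomial_mul, if_neg] at h2
    · exact h2.symm
    · intro hle
      have hji : j ≠ i := by
        rintro rfl
        exact hj hdi
      have := hle i
      simp [hji, hdi] at this
  obtain ⟨s, hs⟩ := hdvd
  have hWs : ∀ j, W j = X j * s := fun j ↦ by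
    refine X_pow_mul_left_cancel i 1 ?_
    rw [pow_one, hcomm, hs]; ring
  refine ⟨s, hWs, ?_⟩
  have h2 : coeff (Finsupp.single i 1) (W i - X i) = 0 := by
    refine coeff_of_lt_order (lt_of_lt_of_le ?_ (hW i))
    rw [Finsupp.degree_single]
    norm_num
  rw [map_sub, coeff_index_single_self_X, hs, coeff_single_mul, coeff_index_single_self_X] at h2
  simpa [sub_eq_zero] using h2

/-- A formal transformation `t ↦ W(t)` tangent to the identity, such that the products of `n`
of the series `1, W i` become polynomials of degree at most `n` after multiplication by a common
series `u`, is a homography. -/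
theorem exists_denominator [Fintype σ] (hn : 1 ≤ n) {u : MvPowerSeries σ R}
    (hu : IsUnit (constantCoeff u)) {W : Option σ → MvPowerSeries σ R} (h1 : W none = 1)
    (hW : ∀ i, 2 ≤ (W (some i) - X i).order)
    (hd : ∀ (I : Fin n → Option σ) (d : σ →₀ ℕ), n < d.degree →
      coeff d (u * ∏ j, W (I j)) = 0) :
    ∃ a : σ → R, (∀ i, (1 + ∑ k, C (a k) * X k) * W (some i) = X i) ∧
      u = C (constantCoeff u) * (1 + ∑ k, C (a k) * X k) ^ n := by
  classical
  obtain ⟨m, rfl⟩ : ∃ m, n = m + 1 := ⟨n - 1, by omega⟩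
  set c := constantCoeff u with hc
  have hC : IsUnit (C c : MvPowerSeries σ R) := hu.map C
  -- Without variables there is no `W i` to divide by, and `u` is its constant term.
  rcases isEmpty_or_nonempty σ with hσ | ⟨⟨i⟩⟩
  · refine ⟨fun _ ↦ 0, fun i ↦ isEmptyElim i, ?_⟩
    ext d
    obtain rfl : d = 0 := Subsingleton.elim _ _
    simp [hc]
  have hprod : ∀ I : Fin (m + 1) → σ, u * ∏ j, W (some (I j)) = C c * ∏ j, X (I j) := fun I ↦
    mul_prod_eq_of_degree_le (W := fun i ↦ W (some i)) hW I (hd fun j ↦ some (I j))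
  have e1 : u * W (some i) ^ (m + 1) = C c * X i ^ (m + 1) := by
    simpa using hprod fun _ ↦ i
  have e2 : ∀ j, u * (W (some j) * W (some i) ^ m) = C c * (X j * X i ^ m) := fun j ↦ by
    simpa [Fin.prod_univ_succ] using hprod (Fin.cons j fun _ ↦ i)
  -- Evaluate `u * W i ^ (m + 1) * W j` in two ways; this avoids dividing by `u`.
  have hcomm : ∀ j, X i * W (some j) = X j * W (some i) := fun j ↦ by
    refine X_pow_mul_left_cancel i m (hC.mul_left_cancel ?_)
    calc C c * (X i ^ m * (X i * W (some j))) = (C c * X i ^ (m + 1)) * W (some j) := by ring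
      _ = W (some i) * (u * (W (some j) * W (some i) ^ m)) := by rw [← e1]; ring
      _ = C c * (X i ^ m * (X j * W (some i))) := by rw [e2]; ring
  obtain ⟨s, hWs, hs1⟩ := exists_common_factor (W := fun i ↦ W (some i)) hW i hcomm
  have hs := hWs i
  have hus : u * s ^ (m + 1) = C c := by
    refine X_pow_mul_left_cancel i (m + 1) ?_
    rw [mul_comm _ (C c), ← e1, hs]; ring
  obtain ⟨c', hc'⟩ := hu.exists_left_inv
  -- This is the inverse of `s`, hence the sought denominator; it remains to see that its degree is
  -- at most one.
  set p := C c' * (u * s ^ m) with hp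
  have hps : p * s = 1 := by
    rw [hp, mul_assoc, mul_assoc, ← pow_succ, hus, ← map_mul, hc', map_one]
  have hp0 : constantCoeff p = 1 := by
    have := congrArg constantCoeff hps
    simpa [hs1] using this
  have hpd : ∀ d : σ →₀ ℕ, 1 < d.degree → coeff d p = 0 := by
    intro d hd1
    -- The word with one `none` and `m` letters `i` gives `X i ^ m * (u * s ^ m)`. Its degree is at
    -- most `m + 1`, which leaves degree at most one for `u * s ^ m`.
    have h2 : u * ∏ j, W ((Fin.cons none fun _ ↦ some i : Fin (m + 1) → Option σ) j) =
        monomial (Finsupp.single i m) 1 * (u * s ^ m) := by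
      rw [Fin.prod_univ_succ, ← X_pow_eq]
      simp [h1, hs]
      ring
    have h3 := hd (Fin.cons none fun _ ↦ some i) (Finsupp.single i m + d)
      (by rw [map_add, Finsupp.degree_single]; omega)
    rw [h2, coeff_add_monomial_mul, one_mul] at h3
    rw [hp, coeff_C_mul, h3, mul_zero]
  refine ⟨fun k ↦ coeff (Finsupp.single k 1) p, ?_, ?_⟩
  · intro j
    rw [← eq_one_add_sum hp0 hpd, hWs, mul_left_comm, hps, mul_one]
  · rw [← eq_one_add_sum hp0 hpd, ← hus, mul_assoc, ← mul_pow, mul_comm s, hps, one_pow, mul_one]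

theorem constantCoeff_aeval {κ : Type*} (W : κ → MvPowerSeries σ R) (Q : MvPolynomial κ R) :
    constantCoeff (MvPolynomial.aeval W Q) =
      MvPolynomial.eval (fun o ↦ constantCoeff (W o)) Q := by
  induction Q using MvPolynomial.induction_on with
  | C a => simp [MvPowerSeries.algebraMap_apply]
  | add p q hp hq => simp [hp, hq]
  | mul_X p o hp => simp [hp]

/-- The chain rule to first order at the origin. -/
theorem coeff_single_aeval {κ : Type*} [Fintype κ] (W : κ → MvPowerSeries σ R)
    (Q : MvPolynomial κ R) (j : σ) :
    coeff (Finsupp.single j 1) (MvPolynomial.aeval W Q) =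
      ∑ o, MvPolynomial.eval (fun o ↦ constantCoeff (W o)) (MvPolynomial.pderiv o Q) *
        coeff (Finsupp.single j 1) (W o) := by
  classical
  induction Q using MvPolynomial.induction_on with
  | C a => simp [MvPowerSeries.algebraMap_apply, coeff_C]
  | add p q hp hq => simp [hp, hq, add_mul, Finset.sum_add_distrib]
  | mul_X p o hp =>
    rw [map_mul, MvPolynomial.aeval_X, coeff_single_mul, hp, constantCoeff_aeval]
    simp only [MvPolynomial.pderiv_mul, MvPolynomial.pderiv_X, map_add, map_mul, add_mul,
      Finset.sum_add_distrib, MvPolynomial.eval_X, Finset.sum_mul]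
    congr 1
    · exact Finset.sum_congr rfl fun _ _ ↦ by ring
    · rw [Finset.sum_eq_single o]
      · simp
      · intro b _ hb
        simp [hb.symm]
      · simp

/-- The matrix of first order coefficients of a tuple of power series. -/
noncomputable def jet (W : Option σ → MvPowerSeries σ R) : Matrix (Option σ) (Option σ) R :=
  Matrix.of fun o o' ↦ o'.elim (constantCoeff (W o)) fun j ↦ coeff (Finsupp.single j 1) (W o)

/-- Differentiate `X i = u * Q i(W)` at the origin. The constant term gives `Q i(w) = 0`, so no
derivative of `u` enters and the gradients of the `Q i`, scaled by `u(0)`, are dual to the linear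
parts of `W`. The vector `y` supplies the remaining row. -/
theorem exists_mul_jet_eq_one [Fintype σ] [DecidableEq σ] {u : MvPowerSeries σ R}
    (hu : IsUnit (constantCoeff u)) {W : Option σ → MvPowerSeries σ R}
    (q : σ → (Fin n → Option σ) → R)
    (hq : ∀ i, X i = u * ∑ I, C (q i I) * ∏ j, W (I j))
    (y : Option σ → R) (hy : ∑ o, C (y o) * W o = 1) :
    ∃ M : Matrix (Option σ) (Option σ) R, M * jet W = 1 := by
  let Q : σ → MvPolynomial (Option σ) R := fun i ↦
    ∑ I, MvPolynomial.C (q i I) * ∏ j, MvPolynomial.X (I j)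
  have hQ : ∀ i, X i = u * MvPolynomial.aeval W (Q i) := fun i ↦ by
    rw [hq]
    simp [Q, MvPowerSeries.algebraMap_apply]
  have hhom : ∀ i, (Q i).IsHomogeneous n := fun i ↦ by
    refine MvPolynomial.IsHomogeneous.sum _ _ _ fun I _ ↦ ?_
    have := MvPolynomial.IsHomogeneous.prod Finset.univ
      (fun j ↦ (MvPolynomial.X (I j) : MvPolynomial (Option σ) R)) (fun _ ↦ 1)
      fun j _ ↦ MvPolynomial.isHomogeneous_X R (I j)
    simpa using (MvPolynomial.isHomogeneous_C (Option σ) (q i I)).mul this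
  set w : Option σ → R := fun o ↦ constantCoeff (W o) with hw
  have hQ0 : ∀ i, MvPolynomial.eval w (Q i) = 0 := fun i ↦ by
    have := congrArg constantCoeff (hQ i)
    rw [constantCoeff_X, map_mul, constantCoeff_aeval] at this
    exact (hu.mul_right_eq_zero).1 this.symm
  -- Euler's identity shows that the gradients annihilate the constant column. It gives `n • Q
  -- i(w)`, which is zero whatever the characteristic.
  have hEuler : ∀ i, ∑ o, MvPolynomial.eval w (MvPolynomial.pderiv o (Q i)) * w o = 0 := fun i ↦ by
    have := congrArg (MvPolynomial.eval w) (hhom i).sum_X_mul_pderiv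
    rw [map_sum, map_nsmul, hQ0, smul_zero] at this
    rw [← this]
    exact Finset.sum_congr rfl fun o _ ↦ by simp [mul_comm]
  refine ⟨Matrix.of fun o' o ↦ o'.elim (y o) fun i ↦
    constantCoeff u * MvPolynomial.eval w (MvPolynomial.pderiv o (Q i)), ?_⟩
  ext a b
  rw [Matrix.mul_apply]
  cases a with
  | none =>
    cases b with
    | none =>
      have := congrArg constantCoeff hy
      simpa [jet] using this
    | some j =>
      have := congrArg (coeff (Finsupp.single j 1)) hy
      simpa [jet, coeff_one] using this
  | some i =>
    cases b with
    | none =>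
      have := hEuler i
      simp only [jet, Matrix.of_apply, Option.elim, mul_assoc, ← Finset.mul_sum]
      simp only [hw] at this
      rw [this]
      simp
    | some j =>
      have := congrArg (coeff (Finsupp.single j 1)) (hQ i)
      rw [coeff_single_mul, constantCoeff_aeval, hQ0, mul_zero, zero_add, coeff_single_aeval,
        coeff_index_single_X] at this
      simp only [jet, Matrix.of_apply, Option.elim, mul_assoc, ← Finset.mul_sum]
      rw [← this]
      simp [Matrix.one_apply, eq_comm]

end PowerSeries

/-! ### The generic pure symbol over `A[[X]]` determines linear maps. -/

section Generic

variable {F : Type u} [Field F] {n : ℕ} {V : Type u} [AddCommGroup V] [Module F V]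
  {A B C : CommAlgCat.{u} F}

/-- The `F`-algebra of formal power series over `A`. -/
noncomputable abbrev powAlg (σ : Type) (A : CommAlgCat.{u} F) : CommAlgCat.{u} F :=
  CommAlgCat.of F (MvPowerSeries σ A)

/-- The inclusion of the constants. -/
noncomputable def toPow (σ : Type) (A : CommAlgCat.{u} F) : A ⟶ powAlg σ A :=
  CommAlgCat.ofHom { (MvPowerSeries.C : A →+* MvPowerSeries σ A) with
    commutes' := fun _ ↦ MvPowerSeries.algebraMap_apply.symm }

theorem toPow_apply (σ : Type) (a : A) : (toPow σ A).hom a = MvPowerSeries.C a := rfl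

/-- The evaluation at the origin. -/
noncomputable def ofPow (σ : Type) (A : CommAlgCat.{u} F) : powAlg σ A ⟶ A :=
  CommAlgCat.ofHom { (MvPowerSeries.constantCoeff : MvPowerSeries σ A →+* A) with
    commutes' := fun r ↦ by
      rw [MvPowerSeries.algebraMap_apply]
      exact MvPowerSeries.constantCoeff_C (algebraMap F A r) }

theorem ofPow_apply (σ : Type) (p : MvPowerSeries σ A) :
    (ofPow σ A).hom p = MvPowerSeries.constantCoeff p := rfl

theorem toPow_comp_ofPow (σ : Type) (A : CommAlgCat.{u} F) : toPow σ A ≫ ofPow σ A = 𝟙 A := by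
  ext a
  change (ofPow σ A).hom ((toPow σ A).hom a) = a
  rw [toPow_apply, ofPow_apply, MvPowerSeries.constantCoeff_C]

variable {σ : Type} (e : Module.Basis (Option σ) F V)

theorem eq_of_gammaCoord {x y : A ⊗[F] Gamma F n V}
    (h : ∀ I : Fin n → Option σ, gammaCoord e I x = gammaCoord e I y) : x = y :=
  gammaIncl_injective <|
    ((Basis.piTensorProduct fun _ : Fin n ↦ e).baseChange A).ext_elem fun I ↦ h I

variable [Fintype σ]

theorem pushDual_generic (q : (Fin n → Option σ) → A) (W : Option σ → MvPowerSeries σ A) :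
    pushDual (toPow σ A) (∑ I, q I • gammaCoord (B := A) e I)
      (pureSymbol n (vec e (B := powAlg σ A) W)) =
      ∑ I, MvPowerSeries.C (q I) * ∏ j, W (I j) := by
  classical
  rw [pushDual_sum_gammaCoord, LinearMap.sum_apply]
  refine Finset.sum_congr rfl fun I _ ↦ ?_
  rw [LinearMap.smul_apply, gammaCoord_pureSymbol, toPow_apply, smul_eq_mul]

/-- A linear form on `A ⊗ Γⁿ(V)` is determined by its value at the generic pure symbol. -/
theorem dual_eq_zero_of_generic (φ : Module.Dual A (A ⊗[F] Gamma F n V))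
    (h : pushDual (toPow σ A) φ (pureSymbol n (vec e (B := powAlg σ A) (gen A))) = 0) :
    φ = 0 := by
  classical
  obtain ⟨q, rfl⟩ := exists_form e φ
  rw [pushDual_generic] at h
  -- Vanishing at the generic symbol does not kill the individual `q I`, only their sums over words
  -- with the same exponent.
  have hq : ∀ d : σ →₀ ℕ, ∑ I with cnt I = d, q I = 0 := fun d ↦ by
    rw [← coeff_form]
    exact (congrArg (MvPowerSeries.coeff d) h).trans (map_zero _)
  refine TensorProduct.AlgebraTensorModule.curry_injective (LinearMap.ext_ring ?_)
  ext s
  set r := (Basis.piTensorProduct fun _ : Fin n ↦ e).repr s.1 with hr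
  have h1 : ∀ I : Fin n → Option σ,
      gammaCoord (B := A) e I (1 ⊗ₜ s) = algebraMap F A (r I) := fun I ↦ by
    simp [gammaCoord, gammaIncl, hr, Algebra.smul_def]
  simp only [TensorProduct.AlgebraTensorModule.curry_apply, LinearMap.restrictScalars_apply,
    TensorProduct.curry_apply, LinearMap.sum_apply, LinearMap.smul_apply, h1, smul_eq_mul,
    LinearMap.zero_apply]
  -- Group the words by exponent: the coordinates of a symmetric tensor are constant on each class,
  -- so only the sums of the `q I` matter.
  rw [← Finset.sum_fiberwise_of_maps_to (t := Finset.univ.image cnt)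
    fun I _ ↦ Finset.mem_image_of_mem cnt (Finset.mem_univ I)]
  refine Finset.sum_eq_zero fun d hd ↦ ?_
  obtain ⟨J, -, rfl⟩ := Finset.mem_image.1 hd
  rw [Finset.sum_congr rfl fun I hI ↦ by
    rw [repr_gamma_eq e s (card_fiber_eq_of_cnt_eq (Finset.mem_filter.1 hI).2)],
    ← Finset.sum_mul, hq, zero_mul]

/-- An endomorphism of `A ⊗ Γⁿ(V)` is determined by its value at the generic pure symbol. -/
theorem end_eq_of_generic {g g' : Module.End A (A ⊗[F] Gamma F n V)}
    (h : pushEnd (toPow σ A) g (pureSymbol n (vec e (B := powAlg σ A) (gen A))) =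
      pushEnd (toPow σ A) g' (pureSymbol n (vec e (B := powAlg σ A) (gen A)))) : g = g' := by
  refine LinearMap.ext fun x ↦ eq_of_gammaCoord e fun I ↦ ?_
  have hsub : pushEnd (toPow σ A) (g - g') = pushEnd (toPow σ A) g - pushEnd (toPow σ A) g' :=
    (pushEnd_unique _ _ _ fun x ↦ by
      rw [LinearMap.sub_apply, LinearMap.sub_apply, pushEnd_push, pushEnd_push, map_sub]).symm
  have := dual_eq_zero_of_generic e (gammaCoord e I ∘ₗ (g - g')) (by
    rw [pushDual_comp_pushEnd, LinearMap.comp_apply, hsub, LinearMap.sub_apply, h, sub_self,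
      map_zero])
  have := LinearMap.congr_fun this x
  rwa [LinearMap.comp_apply, LinearMap.sub_apply, map_sub, LinearMap.zero_apply,
    sub_eq_zero] at this

end Generic

/-! ### Invertible matrices as points of `GL(V)`. -/

section Matrices

variable {F : Type u} [Field F] {V : Type u} [AddCommGroup V] [Module F V]
  {A C : CommAlgCat.{u} F} {ι : Type} [Fintype ι] [DecidableEq ι] (e : Module.Basis ι F V)

/-- The element of `GL(V)(A)` given by an invertible matrix. -/
noncomputable def glOfMatrix (M : (Matrix ι ι A)ˣ) : GLPoints V A :=
  Units.map (Matrix.toLinAlgEquiv (e.baseChange A)).toAlgHom.toMonoidHom M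

theorem glOfMatrix_inv (M : (Matrix ι ι A)ˣ) : (glOfMatrix e M)⁻¹ = glOfMatrix e M⁻¹ :=
  (map_inv _ _).symm

theorem map_glOfMatrix_vec (k : A ⟶ C) (M : (Matrix ι ι A)ˣ) (c : ι → C) :
    (GLPoints.map V k (glOfMatrix e M)).1 (vec e c) =
      vec e (fun o ↦ ∑ o', k.hom (M.1 o o') * c o') := by
  have h1 : ∀ o', (GLPoints.map V k (glOfMatrix e M)).1 (c o' ⊗ₜ e o') =
      ∑ o, (k.hom (M.1 o o') * c o') ⊗ₜ e o := fun o' ↦ by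
    have h2 : c o' ⊗ₜ[F] e o' = c o' • push V k ((1 : A) ⊗ₜ e o') := by
      simp [TensorProduct.smul_tmul']
    have h3 : (glOfMatrix e M).1 ((1 : A) ⊗ₜ e o') = ∑ o, M.1 o o' ⊗ₜ e o := by
      have := Matrix.toLinAlgEquiv_self (e.baseChange A) M.1 o'
      simp only [Module.Basis.baseChange_apply, TensorProduct.smul_tmul', smul_eq_mul,
        mul_one] at this
      exact this
    rw [h2, map_smul, GLPoints.map_push, h3, map_sum, Finset.smul_sum]
    refine Finset.sum_congr rfl fun o _ ↦ ?_
    rw [push_tmul, TensorProduct.smul_tmul', smul_eq_mul, mul_comm]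
  rw [vec, map_sum, Finset.sum_congr rfl fun o' _ ↦ h1 o', Finset.sum_comm, vec]
  exact Finset.sum_congr rfl fun o _ ↦ (TensorProduct.sum_tmul _ _ _).symm

end Matrices

/-! ### Homotheties act trivially on lines. -/

section Homothety

variable {F : Type u} [Field F] {W : Type u} [AddCommGroup W] [Module F W]
  {A B : CommAlgCat.{u} F}

theorem pushEnd_smul (k : A ⟶ B) (c : A) (g : Module.End A (A ⊗[F] W)) :
    pushEnd k (c • g) = k.hom c • pushEnd k g :=
  (pushEnd_unique _ _ _ fun x ↦ by
    rw [LinearMap.smul_apply, LinearMap.smul_apply, push_smul, pushEnd_push]).symm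

theorem glAction_eq_of_smul {g g' : GLPoints W A} {c : A} (hc : IsUnit c)
    (h : g.1 = c • g'.1) : glAction A g = glAction A g' := by
  funext B k
  refine Equiv.ext fun L ↦ Subtype.ext ?_
  change L.1.map (pushEnd k g.1) = L.1.map (pushEnd k g'.1)
  rw [h, pushEnd_smul]
  obtain ⟨d, hd⟩ := (hc.map k.hom).exists_right_inv
  refine le_antisymm ?_ ?_
  · rintro _ ⟨x, hx, rfl⟩
    exact Submodule.smul_mem _ _ (Submodule.mem_map_of_mem hx)
  · rintro _ ⟨x, hx, rfl⟩
    refine ⟨d • x, L.1.smul_mem d hx, ?_⟩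
    rw [map_smul, LinearMap.smul_apply, smul_smul, mul_comm, hd, one_smul]

end Homothety

/-! ### From the formal transformation to an element of `GL(V)`. -/

section Lifting

variable {F : Type u} [Field F] {n : ℕ} {V : Type u} [AddCommGroup V] [Module F V]
  {A : CommAlgCat.{u} F} {σ : Type} [Fintype σ] (e : Module.Basis (Option σ) F V)

theorem pushDual_comp_generic {g : GLPoints (Gamma F n V) A} {u : powAlg σ A}
    {W : Option σ → powAlg σ A}
    (hg : (GLPoints.map _ (toPow σ A) g).1 (pureSymbol n (vec e (B := powAlg σ A) (gen A))) =
      u • pureSymbol n (vec e W)) (φ : Module.Dual A (A ⊗[F] Gamma F n V)) :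
    pushDual (toPow σ A) (φ ∘ₗ g.1) (pureSymbol n (vec e (B := powAlg σ A) (gen A))) =
      u * pushDual (toPow σ A) φ (pureSymbol n (vec e W)) := by
  rw [pushDual_comp_pushEnd, LinearMap.comp_apply]
  change pushDual _ φ ((GLPoints.map _ (toPow σ A) g).1 _) = _
  rw [hg, map_smul, smul_eq_mul]

theorem exists_jet_inverse [DecidableEq σ] (hn : 1 ≤ n) {g : GLPoints (Gamma F n V) A}
    {u : powAlg σ A} (hu : IsUnit (MvPowerSeries.constantCoeff (R := A) u))
    {W : Option σ → powAlg σ A}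
    (hg : (GLPoints.map _ (toPow σ A) g).1 (pureSymbol n (vec e (B := powAlg σ A) (gen A))) =
      u • pureSymbol n (vec e W)) (y : Option σ → A)
    (hy : ∑ o, MvPowerSeries.C (y o) * W o = 1) :
    ∃ M : Matrix (Option σ) (Option σ) A, M * jet (R := A) W = 1 := by
  obtain ⟨m, rfl⟩ : ∃ m, n = m + 1 := ⟨n - 1, by omega⟩
  -- The coordinate at the word `(i, none, …, none)` takes the value `X i` at the generic symbol.
  -- Pulling it back by `g⁻¹` expresses `X i` as `u` times a form in `W`.
  let J : σ → Fin (m + 1) → Option σ := fun i ↦ Fin.cons (some i) fun _ ↦ none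
  choose q hq using fun i ↦ exists_form e (gammaCoord (B := A) e (J i) ∘ₗ g⁻¹.1)
  refine exists_mul_jet_eq_one hu q (fun i ↦ ?_) y hy
  have h1 := pushDual_comp_generic e hg (gammaCoord (B := A) e (J i) ∘ₗ g⁻¹.1)
  have h2 : (gammaCoord (B := A) e (J i) ∘ₗ g⁻¹.1) ∘ₗ g.1 = gammaCoord e (J i) := by
    rw [LinearMap.comp_assoc, ← Module.End.mul_eq_comp, ← Units.val_mul, inv_mul_cancel]
    rfl
  rw [h2, pushDual_gammaCoord, gammaCoord_pureSymbol, hq, pushDual_generic] at h1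
  refine Eq.trans ?_ h1
  simp [J, Fin.prod_univ_succ, gen]

/-- The case where the induced formal transformation is tangent to the identity. -/
theorem exists_unipotent [DecidableEq σ] (hn : 1 ≤ n) {g : GLPoints (Gamma F n V) A}
    {u : MvPowerSeries σ A} (hu : IsUnit (MvPowerSeries.constantCoeff u))
    {W : Option σ → MvPowerSeries σ A} (h1 : W none = 1)
    (hW : ∀ i, 2 ≤ (W (some i) - MvPowerSeries.X i).order)
    (hg : (GLPoints.map _ (toPow σ A) g).1 (pureSymbol n (vec e (B := powAlg σ A) (gen A))) =
      (u : powAlg σ A) • pureSymbol n (vec e (B := powAlg σ A) W)) :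
    ∃ (h : GLPoints V A) (c : A), IsUnit c ∧ g.1 = c • (glGamma n A h).1 := by
  obtain ⟨a, ha, hua⟩ := exists_denominator hn hu h1 hW (fun I d hd ↦ by
    obtain ⟨q, hq⟩ := exists_form e (gammaCoord (B := A) e I ∘ₗ g.1)
    have h2 := pushDual_comp_generic e hg (gammaCoord (B := A) e I)
    rw [hq, pushDual_generic, pushDual_gammaCoord, gammaCoord_pureSymbol] at h2
    have h3 := coeff_form_eq_zero q hd
    rw [← h3]
    exact congrArg (MvPowerSeries.coeff d) h2.symm)
  set l : MvPowerSeries σ A := 1 + ∑ k, MvPowerSeries.C (a k) * MvPowerSeries.X k with hl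
  set c := MvPowerSeries.constantCoeff u with hc
  -- The only nonzero row of `E` is that of `none`, with entries `a`; so `1 + E` sends `(1, X)` to
  -- `(l, X) = l • (1, W)`, and `E * E = 0` gives its inverse.
  let E : Matrix (Option σ) (Option σ) A := Matrix.of fun o o' ↦
    o.elim (o'.elim 0 a) fun _ ↦ 0
  have hE : E * E = 0 := by
    ext o o'
    rw [Matrix.mul_apply, Fintype.sum_option]
    cases o <;> simp [E]
  let N : (Matrix (Option σ) (Option σ) A)ˣ :=
    ⟨1 + E, 1 - E, by rw [add_mul, mul_sub, mul_sub, hE]; simp,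
      by rw [sub_mul, mul_add, mul_add, hE]; simp⟩
  refine ⟨glOfMatrix e N, c, hu, end_eq_of_generic e ?_⟩
  have h4 : (GLPoints.map V (toPow σ A) (glOfMatrix e N)).1 (vec e (B := powAlg σ A) (gen A)) =
      (l : powAlg σ A) • vec e (B := powAlg σ A) W := by
    rw [map_glOfMatrix_vec, smul_vec (B := powAlg σ A)]
    congr 1
    funext o
    rw [Fintype.sum_option]
    cases o with
    | none =>
      simp [N, E, gen, hl, h1]
      rfl
    | some i =>
      rw [ha i]
      simp [N, E, gen, Matrix.one_apply]
  rw [pushEnd_smul, LinearMap.smul_apply]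
  change (GLPoints.map _ (toPow σ A) g).1 _ =
    _ • (GLPoints.map _ (toPow σ A) (glGamma n A (glOfMatrix e N))).1 _
  rw [glGamma_map, glGamma_pureSymbol, h4, pureSymbol_smul, hg, smul_smul, toPow_apply]
  congr 1

/-- Composing with the inverse of the jet makes the constant and linear terms those of `(1, X)`.
Dividing by the entry at `none`, a unit since its constant term is `1`, then brings the tuple to the
form required by `exists_unipotent`. -/
theorem exists_lift [DecidableEq σ] (hn : 1 ≤ n) {g : GLPoints (Gamma F n V) A}
    {u : MvPowerSeries σ A} (hu : IsUnit (MvPowerSeries.constantCoeff u))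
    {W : Option σ → MvPowerSeries σ A}
    (hg : (GLPoints.map _ (toPow σ A) g).1 (pureSymbol n (vec e (B := powAlg σ A) (gen A))) =
      (u : powAlg σ A) • pureSymbol n (vec e (B := powAlg σ A) W)) (y : Option σ → A)
    (hy : ∑ o, MvPowerSeries.C (y o) * W o = 1) :
    ∃ (h : GLPoints V A) (c : A), IsUnit c ∧ g.1 = c • (glGamma n A h).1 := by
  obtain ⟨M, hM⟩ := exists_jet_inverse e hn hu hg y hy
  let H : (Matrix (Option σ) (Option σ) A)ˣ := ⟨jet W, M, mul_eq_one_comm.1 hM, hM⟩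
  let W₁ : Option σ → MvPowerSeries σ A := fun o ↦ ∑ o', MvPowerSeries.C (M o o') * W o'
  have hjet : jet W₁ = 1 := by
    rw [← hM]
    ext o o'
    rw [Matrix.mul_apply]
    cases o' with
    | none => simp [jet, W₁]
    | some j => simp [jet, W₁]
  have hc0 : ∀ o, MvPowerSeries.constantCoeff (W₁ o) = if o = none then 1 else 0 := fun o ↦ by
    rw [← Matrix.one_apply, ← hjet]; rfl
  have hc1 : ∀ o j, MvPowerSeries.coeff (Finsupp.single j 1) (W₁ o) =
      if o = some j then 1 else 0 := fun o j ↦ by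
    rw [← Matrix.one_apply, ← hjet]; rfl
  have hr : IsUnit (W₁ none) := by
    rw [MvPowerSeries.isUnit_iff_constantCoeff, hc0, if_pos rfl]
    exact isUnit_one
  obtain ⟨r, hr⟩ := hr.exists_left_inv
  have hr0 : MvPowerSeries.constantCoeff r = 1 := by
    have := congrArg MvPowerSeries.constantCoeff hr
    rwa [map_mul, hc0, if_pos rfl, mul_one, map_one] at this
  have hvec : vec e (B := powAlg σ A) W₁ =
      (W₁ none : powAlg σ A) • vec e (B := powAlg σ A) fun o ↦ r * W₁ o := by
    rw [smul_vec (B := powAlg σ A)]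
    congr 1
    funext o
    rw [← mul_assoc, mul_comm (W₁ none), hr, one_mul]
  obtain ⟨h, c, hcu, hh⟩ := exists_unipotent (g := glGamma n A (glOfMatrix e H)⁻¹ * g) e hn
    -- Pure symbols are homogeneous of degree `n`, so dividing the vector by `W₁ none` multiplies
    -- `u` by the `n`-th power.
    (u := u * W₁ none ^ n) (W := fun o ↦ r * W₁ o)
    (by simpa [hc0] using hu) hr
    (fun i ↦ by
      refine MvPowerSeries.le_order fun d hd ↦ ?_
      have hd : d.degree < 2 := by exact_mod_cast hd
      rcases Nat.lt_or_ge d.degree 1 with h | h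
      · obtain rfl := (Finsupp.degree_eq_zero_iff d).1 (by omega)
        simp [hc0]
      · obtain ⟨j, rfl⟩ := exists_eq_single_of_degree_eq_one (d := d) (by omega)
        rw [map_sub, coeff_single_mul, hc0, hc1, hr0, MvPowerSeries.coeff_index_single_X]
        simp [eq_comm])
    (by
      rw [map_mul, Units.val_mul, Module.End.mul_apply, hg, map_smul, glGamma_map,
        glGamma_pureSymbol, glOfMatrix_inv, map_glOfMatrix_vec]
      change (u : powAlg σ A) • pureSymbol n (vec e (B := powAlg σ A) W₁) = _
      rw [hvec, pureSymbol_smul (B := powAlg σ A), smul_smul])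
  refine ⟨glOfMatrix e H * h, c, hcu, ?_⟩
  have h5 : g = glGamma n A (glOfMatrix e H) * (glGamma n A (glOfMatrix e H)⁻¹ * g) := by
    rw [← mul_assoc, ← map_mul, mul_inv_cancel, map_one, one_mul]
  rw [h5, Units.val_mul, hh, mul_smul_comm, map_mul, Units.val_mul]

end Lifting

/-! ### Automorphisms preserving pure symbols lift locally. -/

section Stabiliser

variable {F : Type u} [Field F] {n : ℕ} {V : Type u} [AddCommGroup V] [Module F V]
  {A : CommAlgCat.{u} F}

theorem map_span_singleton_eq (g : GLPoints V A) (v : A ⊗[F] V) :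
    (Submodule.span A {v}).map g.1 = Submodule.span A {g.1 v} := by
  rw [Submodule.map_span, Set.image_singleton]

/-- Preservation of the image of the Veronese embedding, in terms of lines. -/
def PreservesSymbols (g : GLPoints (Gamma F n V) A) : Prop :=
  ∀ (B : CommAlgCat.{u} F) (k : A ⟶ B) (L : Submodule B (B ⊗[F] V)), IsLine L →
    ∃ L' : Submodule B (B ⊗[F] V), IsLine L' ∧
      (symbolSpan n L).map (GLPoints.map _ k g).1 = symbolSpan n L'

theorem PreservesSymbols.map {g : GLPoints (Gamma F n V) A} (hg : PreservesSymbols g)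
    {B : CommAlgCat.{u} F} (k : A ⟶ B) : PreservesSymbols (GLPoints.map _ k g) := by
  intro C l L hL
  rw [← GLPoints.map_comp]
  exact hg C (k ≫ l) L hL

/-- Evaluation at the origin is split by the constants, so scalars lift and the image of `L` is
already a submodule. -/
theorem exists_push_eq_of_mem {σ : Type} {L : Submodule (powAlg σ A) (powAlg σ A ⊗[F] V)}
    {x : A ⊗[F] V} (hx : x ∈ pushSubmodule (ofPow σ A) L) :
    ∃ l ∈ L, push V (ofPow σ A) l = x := by
  induction hx using Submodule.span_induction with
  | mem x hx => exact hx
  | zero => exact ⟨0, zero_mem _, map_zero _⟩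
  | add x y _ _ hx hy =>
    obtain ⟨l, hl, rfl⟩ := hx
    obtain ⟨l', hl', rfl⟩ := hy
    exact ⟨l + l', L.add_mem hl hl', map_add _ _ _⟩
  | smul c x _ hx =>
    obtain ⟨l, hl, rfl⟩ := hx
    refine ⟨(toPow σ A).hom c • l, L.smul_mem _ hl, ?_⟩
    rw [push_smul, toPow_apply, ofPow_apply, MvPowerSeries.constantCoeff_C]

variable {σ : Type} [Fintype σ] [DecidableEq σ]

theorem isLine_span_vec (e : Module.Basis (Option σ) F V) {B : CommAlgCat.{u} F}
    {c : Option σ → B} {o : Option σ} (h : c o = 1) :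
    IsLine (Submodule.span B {vec e c}) :=
  isLine_span_singleton ((e.baseChange B).coord o) (by
    rw [Module.Basis.coord_apply, repr_vec, h])

/-- The generic line of the chart is sent to a line over `A[[X]]` whose fibre at the origin is `L`.
A power series with invertible constant term is a unit, so invertibility of a coordinate on `L` lets
the line over `A[[X]]` be spanned by a vector `W` with `W o = 1`, as `exists_lift` needs. -/
theorem exists_lift_of_preserves (e : Module.Basis (Option σ) F V) (hn : 1 ≤ n)
    {g : GLPoints (Gamma F n V) A}
    (hg : PreservesSymbols g) {L : Submodule A (A ⊗[F] V)} (hL : IsLine L)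
    (hLg : (symbolSpan n (Submodule.span A {(1 : A) ⊗ₜ[F] e none})).map g.1 = symbolSpan n L)
    {x : A ⊗[F] V} (hx : x ∈ L) {o : Option σ} (hxo : IsUnit ((e.baseChange A).repr x o)) :
    ∃ (h : GLPoints V A) (c : A), IsUnit c ∧ g.1 = c • (glGamma n A h).1 := by
  set v : powAlg σ A ⊗[F] V := vec e (B := powAlg σ A) (gen A) with hv
  set gB := GLPoints.map _ (toPow σ A) g with hgB
  obtain ⟨L', hL', hLL'⟩ := hg (powAlg σ A) (toPow σ A) _
    (isLine_span_vec e (c := gen A) (o := none) rfl)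
  rw [symbolSpan_span_singleton, map_span_singleton_eq] at hLL'
  have hv0 : push V (ofPow σ A) v = (1 : A) ⊗ₜ e none := by
    rw [hv, push_vec, vec, Fintype.sum_option]
    have h1 : (ofPow σ A).hom (gen A (none : Option σ)) = 1 := map_one _
    have h2 : ∀ i : σ, (ofPow σ A).hom (gen A (some i)) = 0 := fun i ↦
      MvPowerSeries.constantCoeff_X i
    simp [h1, h2]
  -- Specialising at the origin turns the generic vector into `e none` and `gB` back into `g`;
  -- injectivity of the Veronese map then identifies the fibre.
  have hpush : pushSubmodule (ofPow σ A) L' = L := by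
    refine symbolSpan_injective hn (isLine_pushSubmodule _ hL') hL ?_
    rw [symbolSpan_pushSubmodule n _ hL', ← hLL', pushSubmodule_span_singleton,
      ← GLPoints.map_push, ← GLPoints.map_comp, toPow_comp_ofPow, GLPoints.map_id,
      push_pureSymbol, hv0, ← map_span_singleton_eq, ← symbolSpan_span_singleton, hLg]
  rw [← hpush] at hx
  obtain ⟨l, hl, rfl⟩ := exists_push_eq_of_mem hx
  rw [push_repr, ofPow_apply, ← MvPowerSeries.isUnit_iff_constantCoeff] at hxo
  obtain ⟨r, hr⟩ := hxo.exists_left_inv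
  set W : Option σ → powAlg σ A := fun o ↦ r * (e.baseChange (powAlg σ A)).repr l o with hW
  have hWo : W o = 1 := hr
  have hWL : vec e W ∈ L' := by
    rw [hW, ← smul_vec (B := powAlg σ A), vec_repr]
    exact L'.smul_mem _ hl
  have hspan : L' = Submodule.span _ {vec e W} :=
    hL'.eq_span_singleton ((e.baseChange _).coord o) hWL (by
      rw [Module.Basis.coord_apply, repr_vec, hWo])
  rw [hspan, symbolSpan_span_singleton] at hLL'
  obtain ⟨u, hu⟩ := Submodule.mem_span_singleton.1
    (hLL'.le (Submodule.mem_span_singleton_self _))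
  obtain ⟨u', hu'⟩ := Submodule.mem_span_singleton.1
    (hLL'.ge (Submodule.mem_span_singleton_self _))
  -- The coordinate at the constant word `o` equals `1` on the pure symbol of `W`.
  have huu : u' * u = 1 := by
    have h1 := congrArg (gammaCoord (B := powAlg σ A) e fun _ : Fin n ↦ o) hu'
    rw [← hu, smul_smul, map_smul, gammaCoord_pureSymbol, hWo] at h1
    simpa using h1
  have huc : IsUnit (MvPowerSeries.constantCoeff (R := A) (σ := σ) u) :=
    IsUnit.of_mul_eq_one (MvPowerSeries.constantCoeff (R := A) (σ := σ) u') (by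
      have := congrArg (MvPowerSeries.constantCoeff (R := A) (σ := σ)) huu
      rw [mul_comm]
      exact (map_mul (MvPowerSeries.constantCoeff (R := A) (σ := σ)) u' u).symm.trans
        (this.trans (map_one _)))
  refine exists_lift e hn huc (W := W) hu.symm (Pi.single o 1) ?_
  rw [Finset.sum_eq_single o]
  · rw [Pi.single_eq_same, map_one, one_mul]
    exact hWo
  · intro b _ hb
    rw [Pi.single_eq_of_ne hb, map_zero, zero_mul]
  · simp

/-- The coordinates of the vectors in the image of the line of `e none` generate the unit ideal, and
a lift exists wherever one of them is invertible. -/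
theorem span_lift_eq_top_of_basis (e : Module.Basis (Option σ) F V) (hn : 1 ≤ n)
    {g : GLPoints (Gamma F n V) A}
    (hg : PreservesSymbols g) :
    Ideal.span {a : A | ∃ h, (glAction A g).res (toAway A a) =
      glAction (CommAlgCat.of F (Localization.Away a)) (glGamma n _ h)} = ⊤ := by
  have hline : IsLine (Submodule.span A {(1 : A) ⊗ₜ[F] e none}) :=
    isLine_span_singleton ((e.baseChange A).coord none) (by simp)
  obtain ⟨L, hL, hLg⟩ := hg A (𝟙 A) _ hline
  rw [GLPoints.map_id] at hLg
  rw [eq_top_iff, ← hL.span_eq_top, Ideal.span_le]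
  rintro _ ⟨φ, x, hx, rfl⟩
  rw [← (e.baseChange A).sum_repr x, map_sum]
  refine Ideal.sum_mem _ fun o _ ↦ ?_
  rw [map_smul, smul_eq_mul]
  refine Ideal.mul_mem_right _ _ (Ideal.subset_span ?_)
  set a := (e.baseChange A).repr x o with ha
  obtain ⟨h, c, hc, hh⟩ := exists_lift_of_preserves e hn (hg.map (toAway A a))
    (isLine_pushSubmodule (toAway A a) hL) (by
      have h1 : (1 : CommAlgCat.of F (Localization.Away a)) ⊗ₜ[F] e none =
          push V (toAway A a) (1 ⊗ₜ e none) := by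
        rw [push_tmul, map_one]
      rw [symbolSpan_pushSubmodule n _ hL, ← hLg, pushSubmodule_map,
        ← symbolSpan_pushSubmodule n _ hline, pushSubmodule_span_singleton, h1])
    (push_mem_pushSubmodule (toAway A a) hx) (o := o) (by
      rw [push_repr]
      exact toAway_isUnit a)
  exact ⟨h, by rw [res_glAction, glAction_eq_of_smul hc hh]⟩

end Stabiliser

/-! ### Local lifts for arbitrary points of the stabiliser. -/

section LocalLift

variable {F : Type u} [Field F] {n : ℕ} {V : Type u} [AddCommGroup V] [Module F V]
  {A : CommAlgCat.{u} F}

theorem gamma_subsingleton [Subsingleton V] (hn : 1 ≤ n) : Subsingleton (Gamma F n V) := by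
  have : Subsingleton (⨂[F] _ : Fin n, V) := by
    refine ⟨fun x y ↦ ?_⟩
    have h : ∀ z : ⨂[F] _ : Fin n, V, z = 0 := fun z ↦ by
      induction z using PiTensorProduct.induction_on with
      | add x y hx hy => rw [hx, hy, add_zero]
      | smul_tprod r v =>
        rw [(PiTensorProduct.tprod F).map_coord_zero ⟨0, hn⟩ (Subsingleton.elim _ _), smul_zero]
    rw [h x, h y]
  infer_instance

theorem family_eq_of_subsingleton {W : Type u} [AddCommGroup W] [Module F W] [Subsingleton W]
    (f f' : Family (projSpace F W) A) : f = f' := by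
  funext B k
  have : Subsingleton (B ⊗[F] W) := by
    refine ⟨fun x y ↦ ?_⟩
    have h : ∀ z : B ⊗[F] W, z = 0 := fun z ↦ by
      induction z with
      | zero => rfl
      | add x y hx hy => rw [hx, hy, add_zero]
      | tmul b w => rw [Subsingleton.elim w 0, TensorProduct.tmul_zero]
    rw [h x, h y]
  exact Equiv.ext fun L ↦ Subtype.ext (Subsingleton.elim _ _)

theorem preservesSymbols_of_stab {f : Family (projSpace F (Gamma F n V)) A}
    (hf : f ∈ (veroneseStab F n V).points A) {B : CommAlgCat.{u} F} (k : A ⟶ B)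
    {g : GLPoints (Gamma F n V) B} (hg : f.res k = glAction B g) : PreservesSymbols g := by
  intro C l L hL
  have h1 := (hf.2 C (k ≫ l)).le ⟨_, ⟨⟨L, hL⟩, rfl⟩, rfl⟩
  obtain ⟨L', hL'⟩ := h1
  refine ⟨L'.1, L'.2, ?_⟩
  have h2 : f C (k ≫ l) = lineAction C (GLPoints.map _ l g) :=
    congrFun (congrFun hg C) l
  rw [h2] at hL'
  exact (congrArg Subtype.val hL').symm

variable [FiniteDimensional F V]

theorem span_lift_eq_top (hn : 1 ≤ n) {g : GLPoints (Gamma F n V) A}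
    (hg : PreservesSymbols g) :
    Ideal.span {a : A | ∃ h, (glAction A g).res (toAway A a) =
      glAction (CommAlgCat.of F (Localization.Away a)) (glGamma n _ h)} = ⊤ := by
  rcases subsingleton_or_nontrivial V with hV | hV
  · have := gamma_subsingleton (F := F) (V := V) hn
    exact Ideal.eq_top_of_isUnit_mem _
      (Ideal.subset_span (a := (1 : A)) ⟨1, family_eq_of_subsingleton _ _⟩) isUnit_one
  -- One basis vector is singled out as `none`, the origin of the affine chart.
  · obtain ⟨r, hr⟩ : ∃ r, Module.finrank F V = r + 1 :=
      ⟨Module.finrank F V - 1, by have := Module.finrank_pos (R := F) (M := V); omega⟩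
    exact span_lift_eq_top_of_basis
      ((Module.finBasisOfFinrankEq F V hr).reindex (finSuccEquiv r)) hn hg

/-- An element of the stabiliser of the Veronese image is Zariski locally of the form `Γⁿ(h)`. -/
theorem span_lift_eq_top_of_stab (hn : 1 ≤ n) {f : Family (projSpace F (Gamma F n V)) A}
    (hf : f ∈ (veroneseStab F n V).points A) :
    Ideal.span {a : A | ∃ h, f.res (toAway A a) =
      glAction (CommAlgCat.of F (Localization.Away a)) (glGamma n _ h)} = ⊤ := by
  set S := {a : A | ∃ h, f.res (toAway A a) =
      glAction (CommAlgCat.of F (Localization.Away a)) (glGamma n _ h)} with hS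
  rw [Ideal.eq_top_iff_one]
  refine Submodule.mem_of_span_eq_top_of_smul_pow_mem _ _ hf.1.2 1 fun ⟨a, g, hg⟩ ↦ ?_
  have key : (Ideal.span S).map (toAway A a).hom = ⊤ := by
    rw [eq_top_iff, ← span_lift_eq_top hn (preservesSymbols_of_stab hf _ hg), Ideal.span_le]
    rintro b ⟨h, hh⟩
    obtain ⟨m, b', hb'⟩ := toAway_surj a b
    -- Here `b'` is `b` with its denominator cleared, so on `D(a * b')` both `a` and `b` are
    -- invertible and the lift over `D(b)` inside `D(a)` restricts to it.
    have hmem : a * b' ∈ S := by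
      have hu := toAway_isUnit (B := A) (a * b')
      rw [map_mul] at hu
      obtain ⟨l, hl⟩ := toAway_lift (toAway A (a * b')) (a := a) (isUnit_of_mul_isUnit_left hu)
      have hub : IsUnit (l.hom b) := by
        have h2 : l.hom ((toAway A a).hom b') = (toAway A (a * b')).hom b' := by
          conv_rhs => rw [← hl]
          rfl
        rw [← hb', map_mul] at h2
        exact isUnit_of_mul_isUnit_right (h2 ▸ isUnit_of_mul_isUnit_right hu)
      obtain ⟨l', hl'⟩ := toAway_lift l hub
      refine ⟨GLPoints.map V l' h, ?_⟩
      rw [← glGamma_map, ← res_glAction, ← hh, ← hg, ← hl, ← hl']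
      funext C k
      simp [Family.res]
    have h3 : b = ((toAway_isUnit a).pow (m + 1)).unit⁻¹.1 * (toAway A a).hom (a * b') := by
      rw [map_mul, ← hb', ← mul_assoc ((toAway A a).hom a), ← pow_succ', ← mul_assoc,
        IsUnit.val_inv_mul, one_mul]
    rw [SetLike.mem_coe, h3]
    exact Ideal.mul_mem_left _ _ (Ideal.mem_map_of_mem _ (Ideal.subset_span hmem))
  obtain ⟨m, hm⟩ := exists_pow_mem_of_map_eq_top key
  exact ⟨m, by simpa using hm⟩

end LocalLift

/-! ### The arrow `PGL(V) → PGL(Γⁿ(V))` and its image. -/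

section NaturalArrow

variable {F : Type u} [Field F] {n : ℕ} {V : Type u} [AddCommGroup V] [Module F V]
  {A : CommAlgCat.{u} F}

/-- An element of `GL(V)(A)` acting trivially on lines is a homothety. -/
theorem exists_smul_of_glAction_eq_one [FiniteDimensional F V] {g : GLPoints V A}
    (hg : glAction A g = 1) : ∃ c : A, IsUnit c ∧ g.1 = c • 1 := by
  classical
  let e := Module.finBasis F V
  have hline : ∀ v (φ : Module.Dual A (A ⊗[F] V)), φ v = 1 → ∃ c : A, IsUnit c ∧ g.1 v = c • v := by
    intro v φ hv
    have h1 : lineAction A (GLPoints.map V (𝟙 A) g) = 1 := congrFun (congrFun hg A) (𝟙 A)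
    rw [GLPoints.map_id] at h1
    have h2 : (Submodule.span A {v}).map g.1 = Submodule.span A {v} :=
      congrArg Subtype.val (Equiv.congr_fun h1 ⟨_, isLine_span_singleton φ hv⟩)
    rw [map_span_singleton_eq] at h2
    obtain ⟨c, hc⟩ := Submodule.mem_span_singleton.1 (h2.le (Submodule.mem_span_singleton_self _))
    obtain ⟨d, hd⟩ := Submodule.mem_span_singleton.1 (h2.ge (Submodule.mem_span_singleton_self _))
    refine ⟨c, IsUnit.of_mul_eq_one d ?_, hc.symm⟩
    rw [← hc, smul_smul] at hd
    have := congrArg φ hd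
    rwa [map_smul, hv, smul_eq_mul, mul_one, mul_comm] at this
  have hcoord : ∀ i j, (e.baseChange A).coord i ((1 : A) ⊗ₜ e j) = if j = i then 1 else 0 :=
    fun i j ↦ by simp [Finsupp.single_apply]
  choose c hcu hc using fun i ↦ hline ((1 : A) ⊗ₜ e i) ((e.baseChange A).coord i)
    (by rw [hcoord, if_pos rfl])
  have hcc : ∀ i j, c i = c j := by
    intro i j
    by_cases hij : i = j
    · rw [hij]
    -- Every basis vector is an eigenvector; that sums of two of them are too forces the eigenvalues
    -- to coincide.
    obtain ⟨d, -, hd⟩ := hline ((1 : A) ⊗ₜ e i + (1 : A) ⊗ₜ e j) ((e.baseChange A).coord i)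
      (by rw [map_add, hcoord, hcoord, if_pos rfl, if_neg (Ne.symm hij), add_zero])
    rw [map_add, hc, hc, smul_add] at hd
    have h1 := congrArg ((e.baseChange A).coord i) hd
    have h2 := congrArg ((e.baseChange A).coord j) hd
    simp only [map_add, map_smul, hcoord, if_neg hij, if_neg (Ne.symm hij), if_true, smul_eq_mul,
      mul_one, mul_zero, add_zero, zero_add] at h1 h2
    rw [h1, h2]
  rcases isEmpty_or_nonempty (Fin (Module.finrank F V)) with hE | ⟨⟨i⟩⟩
  · exact ⟨1, isUnit_one, (e.baseChange A).ext fun i ↦ isEmptyElim i⟩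
  · refine ⟨c i, hcu i, (e.baseChange A).ext fun j ↦ ?_⟩
    rw [Module.Basis.baseChange_apply, hc, hcc i j]
    rfl

theorem glGamma_smul {g g' : GLPoints V A} {c : A} (h : g.1 = c • g'.1) :
    (glGamma n A g).1 = c ^ n • (glGamma n A g').1 := by
  have h1 : gammaMap n g.1 = c ^ n • gammaMap n g'.1 := by
    refine LinearMap.ext fun t ↦ Subtype.ext ?_
    change PiTensorProduct.map (fun _ ↦ g.1) t.1 = c ^ n • PiTensorProduct.map (fun _ ↦ g'.1) t.1
    rw [h]
    have := (PiTensorProduct.mapMultilinear A (fun _ : Fin n ↦ A ⊗[F] V)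
      (fun _ ↦ A ⊗[F] V)).map_smul_univ (fun _ ↦ c) (fun _ ↦ g'.1)
    simp only [PiTensorProduct.mapMultilinear_apply, Finset.prod_const, Finset.card_univ,
      Fintype.card_fin] at this
    rw [this]
    rfl
  refine LinearMap.ext fun x ↦ ?_
  change (gammaBaseChange n V A).symm (gammaMap n g.1 (gammaBaseChange n V A x)) =
    c ^ n • (gammaBaseChange n V A).symm (gammaMap n g'.1 (gammaBaseChange n V A x))
  rw [h1, LinearMap.smul_apply, map_smul]

theorem veronese_injective (hn : 1 ≤ n) (B : CommAlgCat.{u} F) :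
    Function.Injective ((veronese F n V).app B) := fun L L' h ↦
  Subtype.ext (symbolSpan_injective hn L.2 L'.2 (congrArg Subtype.val h))

/-- The family of permutations of `ℙ(V)` induced by a family stabilising the Veronese image. -/
noncomputable def restrictFamily (hn : 1 ≤ n) {f : Family (projSpace F (Gamma F n V)) A}
    (hf : f ∈ (veroneseStab F n V).points A) : Family (projSpace F V) A := fun B k ↦
  ((Equiv.ofInjective _ (veronese_injective hn B)).trans ((f B k).subtypeEquiv fun x ↦ by
    have h := hf.2 B k
    change f B k '' Set.range _ = Set.range _ at h
    conv_rhs => rw [← h]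
    exact ((f B k).injective.mem_set_image).symm)).trans
    (Equiv.ofInjective _ (veronese_injective hn B)).symm

theorem veronese_restrictFamily (hn : 1 ≤ n) {f : Family (projSpace F (Gamma F n V)) A}
    (hf : f ∈ (veroneseStab F n V).points A) (B : CommAlgCat.{u} F) (k : A ⟶ B)
    (L : (projSpace F V).obj B) :
    (veronese F n V).app B (restrictFamily hn hf B k L) = f B k ((veronese F n V).app B L) :=
  congrArg Subtype.val ((Equiv.ofInjective _ (veronese_injective hn B)).apply_symm_apply _)

theorem restrictFamily_isNatural (hn : 1 ≤ n) {f : Family (projSpace F (Gamma F n V)) A}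
    (hf : f ∈ (veroneseStab F n V).points A) : (restrictFamily hn hf).IsNatural := by
  intro B C h k L
  apply veronese_injective (n := n) hn C
  rw [veronese_restrictFamily, NatTrans.naturality_apply, NatTrans.naturality_apply,
    veronese_restrictFamily, hf.1.1]

theorem restrictFamily_res (hn : 1 ≤ n) {f : Family (projSpace F (Gamma F n V)) A}
    (hf : f ∈ (veroneseStab F n V).points A) {C : CommAlgCat.{u} F} {k : A ⟶ C}
    {g : GLPoints V C} (hg : f.res k = glAction C (glGamma n C g)) :
    (restrictFamily hn hf).res k = glAction C g := by
  funext D l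
  refine Equiv.ext fun L ↦ veronese_injective (n := n) hn D ?_
  change (veronese F n V).app D (restrictFamily hn hf D (k ≫ l) L) = _
  have h1 : f D (k ≫ l) = lineAction D (GLPoints.map _ l (glGamma n C g)) :=
    congrFun (congrFun hg D) l
  rw [veronese_restrictFamily, h1, glGamma_map]
  exact Subtype.ext (symbolSpan_map _ _).symm

variable [FiniteDimensional F V]

/-- The two automorphisms differ by a homothety `c`, hence their divided powers by `c ^ n`. This
makes the gluing datum below well defined. -/
theorem glAction_glGamma_eq {g g' : GLPoints V A} (h : glAction A g = glAction A g') :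
    glAction A (glGamma n A g) = glAction A (glGamma n A g') := by
  obtain ⟨c, hc, hgc⟩ := exists_smul_of_glAction_eq_one (g := g'⁻¹ * g)
    (by rw [map_mul, map_inv, h, inv_mul_cancel])
  refine glAction_eq_of_smul (hc.pow n) (glGamma_smul ?_)
  rw [← mul_inv_cancel_left g' g, Units.val_mul, hgc, mul_smul_comm, mul_one]

/-- The elements `Γⁿ(g)`, where `g` induces a given point of `PGL(V)`. -/
noncomputable def gammaDatum (n : ℕ) (α : (PGL F V).points A) :
    GluingDatum (Gamma F n V) A where
  carrier C k := {x | ∃ g, α.1.res k = glAction C g ∧ x = glGamma n C g}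
  map_mem := by
    rintro C D k l _ ⟨g, hg, rfl⟩
    refine ⟨GLPoints.map V l g, ?_, glGamma_map l g⟩
    rw [← res_glAction, ← hg]
    funext E m
    simp [Family.res]
  glAction_eq := by
    rintro C k _ _ ⟨g, hg, rfl⟩ ⟨g', hg', rfl⟩
    exact glAction_glGamma_eq (hg.symm.trans hg')
  span_eq_top := by
    rw [eq_top_iff, ← α.2.2]
    refine Ideal.span_mono ?_
    rintro a ⟨g, hg⟩
    exact ⟨_, g, hg, rfl⟩

/-- Multiplicativity, compatibility with base change, surjectivity and uniqueness of the arrow all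
reduce to this: a natural family is pinned down by a cover on which it is `Γⁿ` of a linear lift of
`α`. -/
theorem gammaFamily_unique (α : (PGL F V).points A)
    {f : Family (projSpace F (Gamma F n V)) A} (hf : f.IsNatural) {S : Set A}
    (hS : Ideal.span S = ⊤) (h : ∀ a ∈ S, ∃ g, α.1.res (toAway A a) = glAction _ g ∧
      f.res (toAway A a) = glAction _ (glGamma n _ g)) : f = (gammaDatum n α).family := by
  refine Family.eq_of_local hf (gammaDatum n α).family_isNatural hS fun a ha ↦ ?_
  obtain ⟨g, hg, hfg⟩ := h a ha
  rw [hfg, (gammaDatum n α).family_res _ ⟨g, hg, rfl⟩]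

theorem gammaFamily_res (α : (PGL F V).points A) {C : CommAlgCat.{u} F} (k : A ⟶ C)
    {g : GLPoints V C} (hg : α.1.res k = glAction C g) :
    (gammaDatum n α).family.res k = glAction C (glGamma n C g) :=
  (gammaDatum n α).family_res _ ⟨g, hg, rfl⟩

theorem Family.res_res {X : CommAlgCat.{u} F ⥤ Type u} {B C : CommAlgCat.{u} F} (f : Family X A)
    (k : A ⟶ B) (l : B ⟶ C) : (f.res k).res l = f.res (k ≫ l) := by
  funext D m
  simp [Family.res]

theorem span_isLinearAt_and {W : Type u} [AddCommGroup W] [Module F W]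
    {f f' : Family (projSpace F W) A} (hf : f ∈ (PGL F W).points A)
    (hf' : f' ∈ (PGL F W).points A) :
    Ideal.span {a | IsLinearAt f a ∧ IsLinearAt f' a} = ⊤ := by
  rw [eq_top_iff, ← Ideal.mul_top ⊤]
  nth_rw 1 [← hf.2]
  rw [← hf'.2, Ideal.span_mul_span']
  refine Ideal.span_mono ?_
  rintro _ ⟨a, ha, b, hb, rfl⟩
  have hu := toAway_isUnit (a * b)
  rw [map_mul] at hu
  exact ⟨ha.res (toAway A (a * b)) (isUnit_of_mul_isUnit_left hu),
    hb.res (toAway A (a * b)) (isUnit_of_mul_isUnit_right hu)⟩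

theorem gammaFamily_one : (gammaDatum n (1 : (PGL F V).points A)).family = 1 :=
  Eq.symm <| gammaFamily_unique 1 (one_mem (autPoints _ A)) (S := {1}) Ideal.span_singleton_one
    fun a _ ↦ ⟨1, by rw [OneMemClass.coe_one, map_one, map_one], by rw [map_one, map_one, map_one]⟩

theorem gammaFamily_mul (α β : (PGL F V).points A) :
    (gammaDatum n (α * β)).family = (gammaDatum n α).family * (gammaDatum n β).family := by
  refine Eq.symm <| gammaFamily_unique (α * β) ((autPoints _ A).mul_mem
    (gammaDatum n α).family_isNatural (gammaDatum n β).family_isNatural)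
    (span_isLinearAt_and α.2 β.2) ?_
  rintro a ⟨⟨g, hg⟩, ⟨g', hg'⟩⟩
  refine ⟨g * g', ?_, ?_⟩
  · rw [Subgroup.coe_mul, map_mul, map_mul, hg, hg']
  · rw [map_mul, map_mul, map_mul, gammaFamily_res α _ hg, gammaFamily_res β _ hg']

theorem gammaFamily_map (α : (PGL F V).points A) {B : CommAlgCat.{u} F} (k : A ⟶ B) :
    (gammaDatum n ⟨α.1.res k, (PGL F V).res_mem k α.2⟩).family =
      (gammaDatum n α).family.res k := by
  have h := (PGL F V).res_mem k α.2
  refine Eq.symm <| gammaFamily_unique _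
    ((PGL F _).res_mem k (gammaDatum n α).family_mem_PGL).1 h.2 ?_
  rintro b ⟨g, hg⟩
  refine ⟨g, hg, ?_⟩
  rw [Family.res_res] at hg ⊢
  exact gammaFamily_res α _ hg

/-- Equivariance of the Veronese map is an equality of submodules, so it can be checked where `α` is
linear; there it is the identity `Γⁿ(g)[v] = [g v]`. -/
theorem gammaFamily_veronese (α : (PGL F V).points A) {B : CommAlgCat.{u} F} (k : A ⟶ B)
    (L : (projSpace F V).obj B) :
    (gammaDatum n α).family B k ((veronese F n V).app B L) =
      (veronese F n V).app B (α.1 B k L) := by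
  refine Subtype.ext (eq_of_local ((PGL F V).res_mem k α.2).2 ?_)
  rintro b ⟨g, hg⟩
  rw [Family.res_res] at hg
  change pushSubmodule _ ((gammaDatum n α).glue k (symbolSpan n L.1)) =
    pushSubmodule _ (symbolSpan n (α.1 B k L).1)
  have h1 : α.1 _ (k ≫ toAway B b) = lineAction _ g := by
    have := congrFun (congrFun hg _) (𝟙 _)
    change α.1 _ ((k ≫ toAway B b) ≫ 𝟙 _) = lineAction _ (GLPoints.map V (𝟙 _) g) at this
    rwa [Category.comp_id, GLPoints.map_id] at this
  have h2 : pushSubmodule (toAway B b) (α.1 B k L).1 =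
      (pushSubmodule (toAway B b) L.1).map g.1 := by
    have := congrArg Subtype.val (α.2.1 _ _ k (toAway B b) L)
    rw [h1] at this
    exact this.symm
  rw [(gammaDatum n α).pushSubmodule_glue (isLine_symbolSpan n L.2) _ ⟨g, hg, rfl⟩,
    ← symbolSpan_pushSubmodule n _ L.2, ← symbolSpan_map,
    ← symbolSpan_pushSubmodule n _ (α.1 B k L).2, h2]

theorem gammaFamily_mem_stab (α : (PGL F V).points A) :
    (gammaDatum n α).family ∈ (veroneseStab F n V).points A := by
  refine ⟨(gammaDatum n α).family_mem_PGL, fun B k ↦ Set.Subset.antisymm ?_ ?_⟩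
  · rintro _ ⟨_, ⟨L, rfl⟩, rfl⟩
    exact ⟨α.1 B k L, (gammaFamily_veronese α k L).symm⟩
  · rintro _ ⟨L, rfl⟩
    refine ⟨_, ⟨(α.1 B k).symm L, rfl⟩, ?_⟩
    rw [gammaFamily_veronese, Equiv.apply_symm_apply]

theorem gammaFamily_injective (hn : 1 ≤ n) {α β : (PGL F V).points A}
    (h : (gammaDatum n α).family = (gammaDatum n β).family) : α = β := by
  refine Subtype.ext ?_
  funext B k
  refine Equiv.ext fun L ↦ veronese_injective hn B ?_
  rw [← gammaFamily_veronese, h, gammaFamily_veronese]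

/-- The preimage is the restriction of `f` to `ℙ(V)`. The local lifts of `f` show both that it is
locally linear and that `f` is the family glued from it. -/
theorem gammaFamily_surjective (hn : 1 ≤ n) {f : Family (projSpace F (Gamma F n V)) A}
    (hf : f ∈ (veroneseStab F n V).points A) :
    ∃ α : (PGL F V).points A, (gammaDatum n α).family = f := by
  have hS := span_lift_eq_top_of_stab hn hf
  refine ⟨⟨restrictFamily hn hf, restrictFamily_isNatural hn hf, ?_⟩, ?_⟩
  · rw [eq_top_iff, ← hS]
    refine Ideal.span_mono ?_
    rintro a ⟨h, hh⟩
    exact ⟨h, restrictFamily_res hn hf hh⟩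
  · refine Eq.symm <| gammaFamily_unique _ hf.1.1 hS ?_
    rintro a ⟨h, hh⟩
    exact ⟨h, restrictFamily_res hn hf hh, hh⟩

variable (F n V) in
/-- The natural arrow `PGL(V) → PGL(Γⁿ(V))`. -/
noncomputable def naturalArrow :
    (PGL F V).toFunctor ⟶ (PGL F (Gamma F n V)).toFunctor where
  app A := GrpCat.ofHom
    { toFun := fun α : (PGL F V).points A ↦
        (⟨(gammaDatum n α).family, (gammaDatum n α).family_mem_PGL⟩ :
          (PGL F (Gamma F n V)).points A)
      map_one' := Subtype.ext gammaFamily_one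
      map_mul' := fun α β ↦ Subtype.ext (gammaFamily_mul α β) }
  naturality _ _ k := ConcreteCategory.hom_ext _ _ fun α ↦ Subtype.ext (gammaFamily_map α k)

theorem isNaturalArrow_naturalArrow : IsNaturalArrow n (naturalArrow F n V) := by
  intro A g
  refine Subtype.ext <| Eq.symm <| gammaFamily_unique _ (glAction_isNatural _) (S := {1})
    Ideal.span_singleton_one fun a _ ↦ ⟨GLPoints.map V (toAway A a) g, ?_, ?_⟩
  · exact res_glAction _ _
  · rw [← glGamma_map, ← res_glAction]
    rfl

theorem IsNaturalArrow.eq_naturalArrow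
    {Ψ : (PGL F V).toFunctor ⟶ (PGL F (Gamma F n V)).toFunctor} (h : IsNaturalArrow n Ψ) :
    Ψ = naturalArrow F n V := by
  ext A α
  refine Subtype.ext <| gammaFamily_unique α ((Ψ.app A).hom α).2.1 α.2.2 ?_
  rintro a ⟨g, hg⟩
  refine ⟨g, hg, ?_⟩
  -- By naturality, `Ψ` at `α` restricted to `D(a)` is `Ψ` at a point coming from `GL(V)`, where it
  -- is prescribed.
  have h1 := ConcreteCategory.congr_hom (Ψ.naturality (toAway A a)) α
  have h2 : (PGL F V).toFunctor.map (toAway A a) α = glToPGL _ g := Subtype.ext hg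
  have h3 : (Ψ.app _).hom ((PGL F V).toFunctor.map (toAway A a) α) =
    (PGL F (Gamma F n V)).toFunctor.map (toAway A a) ((Ψ.app A).hom α) := h1
  rw [h2, h] at h3
  exact (congrArg Subtype.val h3).symm

variable (F V) in
/-- The isomorphism of `PGL(V)` with the stabiliser of the Veronese image. -/
noncomputable def stabIso (hn : 1 ≤ n) :
    (PGL F V).toFunctor ≅ (veroneseStab F n V).toFunctor :=
  NatIso.ofComponents (fun A ↦ MulEquiv.toGrpIso (X := GrpCat.of ((PGL F V).points A))
    (Y := GrpCat.of ((veroneseStab F n V).points A)) <| MulEquiv.ofBijective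
      ({ toFun := fun α ↦ ⟨(gammaDatum n α).family, gammaFamily_mem_stab α⟩
         map_one' := Subtype.ext gammaFamily_one
         map_mul' := fun α β ↦ Subtype.ext (gammaFamily_mul α β) } :
        (PGL F V).points A →* (veroneseStab F n V).points A)
      ⟨fun _ _ h ↦ gammaFamily_injective hn (congrArg Subtype.val h), fun f ↦
        (gammaFamily_surjective hn f.2).imp fun _ h ↦ Subtype.ext h⟩)
    fun k ↦ ConcreteCategory.hom_ext _ _ fun α ↦ Subtype.ext (gammaFamily_map α k)

end NaturalArrow

end Veronese

theorem mainTheorem5 (F : Type u) [Field F] (V : Type u) [AddCommGroup V] [Module F V]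
    [FiniteDimensional F V] (n : ℕ) (hn : 1 ≤ n) :
    ∃ Φ : (Veronese.PGL F V).toFunctor ⟶ (Veronese.PGL F (Veronese.Gamma F n V)).toFunctor,
      (∀ Ψ, Veronese.IsNaturalArrow n Ψ ↔ Ψ = Φ) ∧
      ∃ φ : (Veronese.PGL F V).toFunctor ≅ (Veronese.veroneseStab F n V).toFunctor,
        φ.hom ≫ Veronese.veroneseStabInclusion F n V = Φ :=
  ⟨Veronese.naturalArrow F n V,
    fun _ ↦ ⟨fun h ↦ h.eq_naturalArrow, fun h ↦ h ▸ Veronese.isNaturalArrow_naturalArrow⟩,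
    Veronese.stabIso F V hn, rfl⟩
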